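/- Let $G$ and $H$ be finite groups and let $m>1$ be an integer. For a finite group $G$ with identity $e$, an element $x\in G\setminus\{e\}$ and integers $1\le k<l\le m+1$, let $\mathbf{x}_{[k,l)}\in G^m$ be the element whose $j$-th coordinate is $x$ for $k\le j<l$ and $e$ otherwise, and let $$\mathcal{S}(m)=\{\mathbf{x}_{[k,l)} : x\in G\setminus\{e\},\ 1\le k<l\le m+1\}\subseteq G^m .$$ Let $\mathscr{G}_m(G)=\mathrm{Cay}(G^m,\mathcal{S}(m))$ be the graph with vertex set $G^m$ in which $\mathbf{g}$ and $\mathbf{h}$ are adjacent if and only if $\mathbf{h}=\mathbf{s}\cdot\mathbf{g}$ for some $\mathbf{s}\in\mathcal{S}(m)$. Then the graphs $\mathscr{G}_m(G)$ and $\mathscr{G}_m(H)$ are isomorphic if and only if the groups $G$ and $H$ are isomorphic. -/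

import Mathlib

/-- The Cayley graph `Cay(Γ, S)` of a group `Γ` with respect to a symmetric set `S ⊆ Γ ∖ {1}`:
`g` and `h` are adjacent iff `h = s * g` for some `s ∈ S` (left multiplication). -/
def cayGraph {Γ : Type*} [Group Γ] (S : Set Γ) (hone : (1 : Γ) ∉ S)
    (hsymm : ∀ s ∈ S, s⁻¹ ∈ S) : SimpleGraph Γ where
  Adj g h := ∃ s ∈ S, h = s * g
  symm := ⟨by
    rintro g h ⟨s, hs, rfl⟩
    exact ⟨s⁻¹, hsymm s hs, by simp⟩⟩
  loopless := ⟨by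
    rintro g ⟨s, hs, h⟩
    have h1 : s = 1 := by simpa using h.symm
    exact hone (h1 ▸ hs)⟩

/-- The element `x_[k,l)` of `G ^ m` whose `j`-th coordinate (`1 ≤ j ≤ m`) is `x` if `k ≤ j < l` and
the identity otherwise. The index `i : Fin m` stands for the coordinate `j = i + 1`. -/
def intervalElem {G : Type*} [Group G] (m : ℕ) (x : G) (k l : ℕ) : Fin m → G :=
  fun i => if k ≤ (i : ℕ) + 1 ∧ (i : ℕ) + 1 < l then x else 1

/-- The union of all intervals: all `x_[k,l)` with `x ≠ 1` and `1 ≤ k < l ≤ m + 1`. -/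
def intervalSet (G : Type*) [Group G] (m : ℕ) : Set (Fin m → G) :=
  {s | ∃ (x : G) (k l : ℕ), x ≠ 1 ∧ 1 ≤ k ∧ k < l ∧ l ≤ m + 1 ∧ s = intervalElem m x k l}

theorem one_notMem_intervalSet (G : Type*) [Group G] (m : ℕ) :
    (1 : Fin m → G) ∉ intervalSet G m := by
  rintro ⟨x, k, l, hx, hk, hkl, hl, h⟩
  have h1 := congrFun h ⟨k - 1, by omega⟩
  have h2 : k ≤ k - 1 + 1 ∧ k - 1 + 1 < l := by omega
  simp only [intervalElem, Pi.one_apply, if_pos h2] at h1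
  exact hx h1.symm

theorem inv_mem_intervalSet (G : Type*) [Group G] (m : ℕ) :
    ∀ s ∈ intervalSet G m, s⁻¹ ∈ intervalSet G m := by
  rintro s ⟨x, k, l, hx, hk, hkl, hl, rfl⟩
  refine ⟨x⁻¹, k, l, inv_ne_one.mpr hx, hk, hkl, hl, ?_⟩
  funext i
  simp only [intervalElem, Pi.inv_apply]
  split_ifs <;> simp

/-- The graph `𝒢_m(G) = Cay(G ^ m, S(m))`. -/
def intervalCayGraph (m : ℕ) (G : Type*) [Group G] : SimpleGraph (Fin m → G) :=
  cayGraph (intervalSet G m) (one_notMem_intervalSet G m) (inv_mem_intervalSet G m)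

/-!
Partial quotients turn `G ^ m` into the code of the words `d` of length `m + 1` over `G` with
product one, and `𝒢_m(G)` into the graph in which two codewords are adjacent iff they differ at
exactly two positions. Codewords that agree off a given pair of positions form a clique, a *line*.
For `|G| ≥ 5`, the way maximal cliques through a vertex meet distinguishes lines from the other
maximal cliques, so an isomorphism `φ` maps lines to lines. If moreover some `x : G` has
`x * x ≠ 1`, then `φ` maps some *plane* of codewords `(x, y, (x * y)⁻¹)`, with all other letters
trivial, onto a plane, acting on each letter separately. This is a homotopy from `G` to `H` or to
its opposite, which yields a group isomorphism.

Whether `x * x = 1` for all `x` can be read off the graph from the number of connected components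
of the common neighbours of an edge. Groups with this property are vector spaces over `ZMod 2`,
determined by their cardinality, and the remaining groups with at most four elements are cyclic.
-/

section LatinCode

variable {ι G : Type*} {C : Set (ι → G)}

/-- A Latin code is a set of words in which the letter at any position is determined by the letters
at the other positions, which are arbitrary. -/
def IsLatinCode (C : Set (ι → G)) : Prop :=
  ∀ (w : ι → G) (i : ι), ∃! u : C, ∀ k ≠ i, u.1 k = w k

/-- The graph on a code in which two codewords are adjacent iff they differ at exactly two
positions, the least possible number in a Latin code. -/
def codeGraph (C : Set (ι → G)) : SimpleGraph C where
  Adj u v := ∃ i j, i ≠ j ∧ ∀ k, u.1 k ≠ v.1 k ↔ k = i ∨ k = j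
  symm := ⟨by
    rintro u v ⟨i, j, hij, h⟩
    exact ⟨i, j, hij, fun k => ne_comm.trans (h k)⟩⟩
  loopless := ⟨by
    rintro u ⟨i, j, -, h⟩
    exact (h i).2 (Or.inl rfl) rfl⟩

/-- The flat through the codeword `u` with set of directions `s`: the codewords that agree with `u`
off `s`. It is a line if `s` consists of two positions, and a plane if `s` consists of three. -/
def codeFlat (u : C) (s : Set ι) : Set C := {v | ∀ k ∉ s, v.1 k = u.1 k}

/-- The star of a word `w`, usually not a codeword: the codewords that differ from `w` in at most
one position. -/
def codeStar (C : Set (ι → G)) (w : ι → G) : Set C := {v | ∃ i, ∀ k ≠ i, v.1 k = w k}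

/-- Two cliques through the vertex `u` are close at `u` if, apart from `u`, they share a vertex or
contain adjacent vertices. Disjoint lines are not close, but a star is close to all lines and stars
through its points, so that closeness tells lines from stars. -/
def AreCloseAt {V : Type*} (Γ : SimpleGraph V) (u : V) (A B : Set V) : Prop :=
  ∃ p ∈ A, ∃ q ∈ B, p ≠ u ∧ q ≠ u ∧ (p = q ∨ Γ.Adj p q)

theorem mem_codeFlat_pair {u v : C} {i j : ι} :
    v ∈ codeFlat u {i, j} ↔ ∀ k, k ≠ i → k ≠ j → v.1 k = u.1 k := by
  simp [codeFlat]

theorem mem_codeFlat_self (u : C) (s : Set ι) : u ∈ codeFlat u s :=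
  fun _ _ => rfl

theorem codeFlat_mono (u : C) {s t : Set ι} (h : s ⊆ t) : codeFlat u s ⊆ codeFlat u t :=
  fun _ hv k hk => hv k fun hks => hk (h hks)

theorem codeFlat_eq_of_mem {u v : C} {s : Set ι} (h : v ∈ codeFlat u s) :
    codeFlat v s = codeFlat u s :=
  Set.ext fun _ => forall₂_congr fun k hk => by rw [h k hk]

theorem mem_codeFlat_of_adj {u v : C} {i j : ι} (h : (codeGraph C).Adj u v) (hij : i ≠ j)
    (hi : v.1 i ≠ u.1 i) (hj : v.1 j ≠ u.1 j) : v ∈ codeFlat u {i, j} := by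
  obtain ⟨a, b, -, h⟩ := h
  exact mem_codeFlat_pair.2 fun k hki hkj => by grind

theorem not_adj_of_ne_of_ne_of_ne {u v : C} {i j k : ι} (hij : i ≠ j) (hik : i ≠ k) (hjk : j ≠ k)
    (hi : v.1 i ≠ u.1 i) (hj : v.1 j ≠ u.1 j) (hk : v.1 k ≠ u.1 k) : ¬ (codeGraph C).Adj u v :=
  fun h => hk (mem_codeFlat_pair.1 (mem_codeFlat_of_adj h hij hi hj) k hik.symm hjk.symm)

theorem codeGraph_triangle {u v w : C} {i j : ι} (hij : i ≠ j)
    (huv : ∀ k, v.1 k ≠ u.1 k ↔ k = i ∨ k = j) (hu : (codeGraph C).Adj u w)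
    (hv : (codeGraph C).Adj v w) :
    w ∈ codeFlat u {i, j} ∨ (∃ l, l ≠ i ∧ l ≠ j ∧ w ∈ codeFlat u {i, l} ∧ w.1 i = v.1 i) ∨
      ∃ l, l ≠ i ∧ l ≠ j ∧ w ∈ codeFlat u {j, l} ∧ w.1 j = v.1 j := by
  refine or_iff_not_imp_left.2 fun hw => ?_
  obtain ⟨l, hli, hlj, hwu⟩ : ∃ l, l ≠ i ∧ l ≠ j ∧ w.1 l ≠ u.1 l := by
    simpa only [mem_codeFlat_pair, not_forall, exists_prop] using hw
  have hwv : w.1 l ≠ v.1 l := by grind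
  rcases ne_or_eq (w.1 i) (u.1 i) with hi | hi
  · have hmem := mem_codeFlat_of_adj hu hli.symm hi hwu
    have hj : w.1 j ≠ v.1 j := by grind [mem_codeFlat_pair]
    refine Or.inl ⟨l, hli, hlj, hmem, ?_⟩
    exact mem_codeFlat_pair.1 (mem_codeFlat_of_adj hv hlj.symm hj hwv) i hij hli.symm
  · have hwj := mem_codeFlat_pair.1
      (mem_codeFlat_of_adj hv hli.symm (hi ▸ ((huv i).2 (Or.inl rfl)).symm) hwv) j hij.symm hlj.symm
    have hj : w.1 j ≠ u.1 j := hwj ▸ (huv j).2 (Or.inr rfl)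
    exact Or.inr ⟨l, hli, hlj, mem_codeFlat_of_adj hu hlj.symm hj hwu, hwj⟩

/-- The only common neighbour outside the star of `c` of three points of the star is obtained from
`c` by changing the three letters in which these points differ from `c`. -/
theorem antipode_of_notMem_codeStar {c : ι → G} {u v w z : C} {i j l : ι}
    (hij : i ≠ j) (hil : i ≠ l) (hjl : j ≠ l) (hu : ∀ k, u.1 k ≠ c k ↔ k = i)
    (hv : ∀ k, v.1 k ≠ c k ↔ k = j) (hw : ∀ k, w.1 k ≠ c k ↔ k = l) (hz : z ∉ codeStar C c)
    (hzu : (codeGraph C).Adj u z) (hzv : (codeGraph C).Adj v z) (hzw : (codeGraph C).Adj w z) :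
    z.1 i = u.1 i ∧ z.1 j = v.1 j ∧ z.1 l = w.1 l ∧ ∀ k, k ≠ i → k ≠ j → k ≠ l → z.1 k = c k := by
  have huv (k) : v.1 k ≠ u.1 k ↔ k = i ∨ k = j := by grind
  have hz' (k) : ∃ k' ≠ k, z.1 k' ≠ c k' := by
    simpa only [codeStar, Set.mem_ofPred_eq, not_exists, not_forall, exists_prop] using
      not_exists.1 hz k
  rcases codeGraph_triangle hij huv hzu hzv with h | ⟨p, _, _, h, hzi⟩ | ⟨p, hpi, _, h, hzj⟩
  all_goals rw [mem_codeFlat_pair] at h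
  · obtain ⟨k, hkj, hzk⟩ := hz' j
    obtain ⟨k', hki, hzk'⟩ := hz' i
    refine absurd hzw (not_adj_of_ne_of_ne_of_ne hij hil hjl ?_ ?_ ?_) <;> grind
  · obtain ⟨k, hk, hzk⟩ := hz' p
    grind
  · have hzl := mem_codeFlat_pair.1 (mem_codeFlat_of_adj hzw hij (by grind) (by grind)) l
      hil.symm hjl.symm
    grind

namespace IsLatinCode

theorem eq_of_forall_ne (hC : IsLatinCode C) {u v : C} (i : ι) (h : ∀ k ≠ i, u.1 k = v.1 k) :
    u = v :=
  (hC v.1 i).unique h fun _ _ => rfl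

theorem ne_iff_of_mem_codeFlat (hC : IsLatinCode C) {u v : C} {i j : ι}
    (hv : v ∈ codeFlat u {i, j}) (huv : v ≠ u) (k : ι) : v.1 k ≠ u.1 k ↔ k = i ∨ k = j := by
  rw [mem_codeFlat_pair] at hv
  refine ⟨fun hk => by grind, ?_⟩
  rintro (rfl | rfl) hk
  · exact huv (hC.eq_of_forall_ne j fun l hl => by grind)
  · exact huv (hC.eq_of_forall_ne i fun l hl => by grind)

theorem eq_of_mem_codeFlat (hC : IsLatinCode C) {u v w : C} {i j : ι}
    (hv : v ∈ codeFlat u {i, j}) (hw : w ∈ codeFlat u {i, j}) (h : v.1 i = w.1 i) : v = w := by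
  by_contra hvw
  rw [← codeFlat_eq_of_mem hw] at hv
  exact (hC.ne_iff_of_mem_codeFlat hv hvw i).2 (Or.inl rfl) h

theorem exists_mem_codeFlat (hC : IsLatinCode C) (u : C) {i j : ι} (hij : i ≠ j) (x : G) :
    ∃ v ∈ codeFlat u {i, j}, v.1 i = x := by
  classical
  obtain ⟨v, hv, -⟩ := hC (Function.update u.1 i x) j
  exact ⟨v, mem_codeFlat_pair.2 fun k hki hkj => by simp [hv k hkj, hki], by simp [hv i hij]⟩

theorem encard_codeFlat (hC : IsLatinCode C) (u : C) {i j : ι} (hij : i ≠ j) :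
    (codeFlat u {i, j}).encard = ENat.card G :=
  ENat.card_congr <| Equiv.ofBijective (fun v : codeFlat u {i, j} => v.1.1 i)
    ⟨fun v w h => Subtype.ext (hC.eq_of_mem_codeFlat v.2 w.2 h), fun x =>
      let ⟨v, hv, hvx⟩ := hC.exists_mem_codeFlat u hij x
      ⟨⟨v, hv⟩, hvx⟩⟩

theorem adj_of_mem_codeFlat (hC : IsLatinCode C) {u v : C} {i j : ι} (hij : i ≠ j)
    (hv : v ∈ codeFlat u {i, j}) (huv : v ≠ u) : (codeGraph C).Adj v u :=
  ⟨i, j, hij, hC.ne_iff_of_mem_codeFlat hv huv⟩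

theorem isClique_codeFlat (hC : IsLatinCode C) (u : C) {i j : ι} (hij : i ≠ j) :
    (codeGraph C).IsClique (codeFlat u {i, j}) := fun v hv w hw hvw =>
  hC.adj_of_mem_codeFlat hij (by rwa [codeFlat_eq_of_mem hw]) hvw

theorem adj_of_mem_codeStar (hC : IsLatinCode C) {w : ι → G} {u v : C} (hu : u ∈ codeStar C w)
    (hv : v ∈ codeStar C w) (huv : u ≠ v) : (codeGraph C).Adj u v := by
  obtain ⟨i, hi⟩ := hu
  obtain ⟨j, hj⟩ := hv
  have hij : i ≠ j := by
    rintro rfl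
    exact huv (hC.eq_of_forall_ne i fun k hk => (hi k hk).trans (hj k hk).symm)
  exact hC.adj_of_mem_codeFlat hij (mem_codeFlat_pair.2 fun k hki hkj => by grind) huv

theorem encard_codeStar_le (hC : IsLatinCode C) (w : ι → G) :
    (codeStar C w).encard ≤ ENat.card ι := by
  choose p hp using fun v : codeStar C w => v.2
  exact ENat.card_le_card_of_injective (f := p) fun u v h =>
    Subtype.ext (hC.eq_of_forall_ne (p u) fun k hk => (hp u k hk).trans (hp v k (h ▸ hk)).symm)

/-- A codeword off the line differs from some point of the line in three positions. -/
theorem maximal_isClique_codeFlat (hC : IsLatinCode C) (hG : 3 ≤ ENat.card G) (u : C) {i j : ι}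
    (hij : i ≠ j) : Maximal (codeGraph C).IsClique (codeFlat u {i, j}) := by
  refine ⟨hC.isClique_codeFlat u hij, fun K hK hle p hp => mem_codeFlat_pair.2 ?_⟩
  by_contra! ⟨k, hki, hkj, hk⟩
  obtain ⟨v₀, hv₀, hv₀j⟩ := hC.exists_mem_codeFlat u hij.symm (p.1 j)
  obtain ⟨x, hxp, hxv⟩ := ENat.exists_ne_ne_of_three_le hG (p.1 i) (v₀.1 i)
  obtain ⟨v, hv, rfl⟩ := hC.exists_mem_codeFlat u hij x
  have hvj : v.1 j ≠ p.1 j := hv₀j ▸ fun h => hxv (congrArg (fun q : C => q.1 i) <|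
    hC.eq_of_mem_codeFlat (Set.pair_comm i j ▸ hv) hv₀ h)
  have hvk : v.1 k ≠ p.1 k := (mem_codeFlat_pair.1 hv k hki hkj).trans_ne hk.symm
  exact not_adj_of_ne_of_ne_of_ne hij hki.symm hkj.symm hxp hvj hvk
    (hK hp (hle hv) fun h => hxp (h ▸ rfl))

theorem ne_iff_of_mem_codeStar (hC : IsLatinCode C) {w : ι → G} {u v : C} (hu : u ∈ codeStar C w)
    (hv : v ∈ codeStar C w) (huv : u ≠ v) : ∃ i, ∀ k, u.1 k ≠ w k ↔ k = i := by
  obtain ⟨i, hi⟩ := hu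
  refine ⟨i, fun k => ⟨fun hk => by_contra fun hki => hk (hi k hki), ?_⟩⟩
  rintro rfl hk
  obtain ⟨j, hj⟩ := hv
  exact huv (hC.eq_of_forall_ne j fun l hl => by grind)

theorem subset_codeStar_of_isClique (hC : IsLatinCode C) {K : Set C}
    (hK : (codeGraph C).IsClique K) (h5 : 5 ≤ K.encard) {c : ι → G} {u v w : C} {i j l : ι}
    (hij : i ≠ j) (hil : i ≠ l) (hjl : j ≠ l) (hu : ∀ k, u.1 k ≠ c k ↔ k = i)
    (hv : ∀ k, v.1 k ≠ c k ↔ k = j) (hw : ∀ k, w.1 k ≠ c k ↔ k = l) (huK : u ∈ K) (hvK : v ∈ K)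
    (hwK : w ∈ K) : K ⊆ codeStar C c := by
  classical
  intro z hzK
  by_contra hz
  have hne (x : C) (p : ι) (hx : ∀ k, x.1 k ≠ c k ↔ k = p) (y : C) (hy : y ∉ codeStar C c) :
      x ≠ y := fun h => hy ⟨p, fun k hk => by grind⟩
  have antipode (y : C) (hyK : y ∈ K) (hy : y ∉ codeStar C c) :=
    antipode_of_notMem_codeStar hij hil hjl hu hv hw hy (hK huK hyK (hne u i hu y hy))
      (hK hvK hyK (hne v j hv y hy)) (hK hwK hyK (hne w l hw y hy))
  obtain ⟨y, hyK, hy⟩ : ∃ y ∈ K, y ∉ ({u, v, w, z} : Finset C) := by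
    by_contra! h
    have hcard : (5 : ℕ∞) ≤ (({u, v, w, z} : Finset C) : Set C).encard :=
      h5.trans (Set.encard_le_encard h)
    rw [Set.encard_coe_eq_coe_finsetCard, Nat.ofNat_le_cast] at hcard
    exact absurd (hcard.trans Finset.card_le_four) (by norm_num)
  simp only [Finset.mem_insert, Finset.mem_singleton, not_or] at hy
  obtain ⟨hyu, hyv, hyw, hyz⟩ := hy
  obtain ⟨hzi, hzj, hzl, _⟩ := antipode z hzK hz
  by_cases hyc : y ∈ codeStar C c
  · obtain ⟨p, hp⟩ := hyc
    have hpi : p ≠ i := fun h => hyu (hC.eq_of_forall_ne p fun k hk => by grind)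
    have hpj : p ≠ j := fun h => hyv (hC.eq_of_forall_ne p fun k hk => by grind)
    have hpl : p ≠ l := fun h => hyw (hC.eq_of_forall_ne p fun k hk => by grind)
    refine not_adj_of_ne_of_ne_of_ne hij hil hjl ?_ ?_ ?_ (hK hzK hyK (Ne.symm hyz)) <;> grind
  · obtain ⟨_, hyj, hyl, _⟩ := antipode y hyK hyc
    exact hyz (hC.eq_of_forall_ne i fun k hk => by grind)

theorem subset_codeFlat_or_subset_codeStar (hC : IsLatinCode C) {K : Set C}
    (hK : (codeGraph C).IsClique K) (h5 : 5 ≤ K.encard) :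
    (∃ u i j, i ≠ j ∧ K ⊆ codeFlat u {i, j}) ∨ ∃ w, K ⊆ codeStar C w := by
  classical
  obtain ⟨u, v, huK, hvK, huv⟩ : ∃ u v, u ∈ K ∧ v ∈ K ∧ u ≠ v :=
    Set.one_lt_encard_iff.1 (lt_of_lt_of_le (by norm_num) h5)
  obtain ⟨i, j, hij, hvu⟩ := hK hvK huK huv.symm
  refine or_iff_not_imp_left.2 fun hline => ?_
  obtain ⟨w, hwK, hw⟩ := Set.not_subset.1 fun h => hline ⟨u, i, j, hij, h⟩
  have hwu : w ≠ u := fun h => hw (h ▸ mem_codeFlat_self u _)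
  have hwv : w ≠ v := fun h => hw (mem_codeFlat_pair.2 fun k hki hkj => by grind)
  obtain h | ⟨l, hli, hlj, h, hwi⟩ | ⟨l, hli, hlj, h, hwj⟩ :=
    codeGraph_triangle hij hvu (hK huK hwK hwu.symm) (hK hvK hwK hwv.symm)
  · exact absurd h hw
  · have hwl := hC.ne_iff_of_mem_codeFlat h hwu
    exact ⟨Function.update u.1 i (v.1 i), hC.subset_codeStar_of_isClique hK h5 hij hli.symm hlj.symm
      (fun k => by grind) (fun k => by grind) (fun k => by grind) huK hvK hwK⟩
  · have hwl := hC.ne_iff_of_mem_codeFlat h hwu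
    exact ⟨Function.update u.1 j (v.1 j), hC.subset_codeStar_of_isClique hK h5 hij.symm hlj.symm
      hli.symm (fun k => by grind) (fun k => by grind) (fun k => by grind) huK hvK hwK⟩

theorem exists_mem_codeStar_inter_codeFlat (hC : IsLatinCode C) {w : ι → G} {u : C} {i l : ι}
    (hu : ∀ k, u.1 k ≠ w k ↔ k = i) (hil : i ≠ l) :
    ∃ p ∈ codeStar C w, p ∈ codeFlat u {i, l} ∧ p ≠ u := by
  obtain ⟨p, hp, -⟩ := hC w l
  exact ⟨p, ⟨l, hp⟩, mem_codeFlat_pair.2 fun k hki hkl => by grind,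
    fun h => (hu i).2 rfl (h ▸ hp i hil)⟩

theorem eq_or_adj_of_mem_codeFlat (hC : IsLatinCode C) {u p q : C} {i j : ι} (hij : i ≠ j)
    (hp : p ∈ codeFlat u {i, j}) (hq : q ∈ codeFlat u {i, j}) :
    p = q ∨ (codeGraph C).Adj p q :=
  or_iff_not_imp_left.2 (hC.isClique_codeFlat u hij hp hq)

theorem areCloseAt_codeStar_codeStar (hC : IsLatinCode C) {w w' : ι → G} {u : C} {i i' : ι}
    [Nontrivial ι] (hu : ∀ k, u.1 k ≠ w k ↔ k = i) (hu' : ∀ k, u.1 k ≠ w' k ↔ k = i') :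
    AreCloseAt (codeGraph C) u (codeStar C w) (codeStar C w') := by
  obtain ⟨l, hil, h⟩ : ∃ l, i ≠ l ∧ (i = i' ∨ l = i') := by
    by_cases h : i = i'
    · exact (exists_ne i).imp fun l hl => ⟨hl.symm, Or.inl h⟩
    · exact ⟨i', h, Or.inr rfl⟩
  obtain ⟨p, hp, hpl, hpu⟩ := hC.exists_mem_codeStar_inter_codeFlat hu hil
  obtain ⟨q, hq, hql, hqu⟩ : ∃ q ∈ codeStar C w', q ∈ codeFlat u {i, l} ∧ q ≠ u := by
    rcases h with rfl | rfl
    · exact hC.exists_mem_codeStar_inter_codeFlat hu' hil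
    · exact Set.pair_comm i l ▸ hC.exists_mem_codeStar_inter_codeFlat hu' hil.symm
  exact ⟨p, hp, q, hq, hpu, hqu, hC.eq_or_adj_of_mem_codeFlat hil hpl hql⟩

theorem areCloseAt_codeStar_codeFlat (hC : IsLatinCode C) {w : ι → G} {u : C} {i a b : ι}
    (hab : a ≠ b) (hu : ∀ k, u.1 k ≠ w k ↔ k = i) :
    AreCloseAt (codeGraph C) u (codeStar C w) (codeFlat u {a, b}) := by
  by_cases hi : i = a ∨ i = b
  · obtain ⟨l, hil, h⟩ : ∃ l, i ≠ l ∧ ({i, l} : Set ι) = {a, b} := by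
      rcases hi with rfl | rfl
      · exact ⟨b, hab, rfl⟩
      · exact ⟨a, hab.symm, Set.pair_comm _ _⟩
    obtain ⟨p, hp, hpl, hpu⟩ := hC.exists_mem_codeStar_inter_codeFlat hu hil
    exact ⟨p, hp, p, h ▸ hpl, hpu, hpu, Or.inl rfl⟩
  · rw [not_or] at hi
    obtain ⟨p, hp, hpl, hpu⟩ := hC.exists_mem_codeStar_inter_codeFlat hu hi.1
    obtain ⟨q, hq, hqa⟩ := hC.exists_mem_codeFlat u hab (p.1 a)
    have hpu' := hC.ne_iff_of_mem_codeFlat hpl hpu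
    have hpq : p ∈ codeFlat q {i, b} := by
      simp only [mem_codeFlat_pair] at *
      grind
    exact ⟨p, hp, q, hq, hpu, by grind, or_iff_not_imp_left.2 (hC.adj_of_mem_codeFlat hi.2 hpq)⟩

theorem not_areCloseAt_codeFlat (hC : IsLatinCode C) {u : C} {i j k l : ι} (hij : i ≠ j)
    (hik : i ≠ k) (hil : i ≠ l) (hjk : j ≠ k) (hjl : j ≠ l) :
    ¬ AreCloseAt (codeGraph C) u (codeFlat u {i, j}) (codeFlat u {k, l}) := by
  rintro ⟨p, hp, q, hq, hpu, hqu, h⟩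
  have hpu := hC.ne_iff_of_mem_codeFlat hp hpu
  have hqu := hC.ne_iff_of_mem_codeFlat hq hqu
  have hqk : q.1 k ≠ p.1 k := by grind
  exact not_adj_of_ne_of_ne_of_ne hij hik hjk (by grind) (by grind) hqk
    (h.resolve_left fun h => hqk (h ▸ rfl))

end IsLatinCode

end LatinCode

theorem maximal_isClique_image {V W : Type*} {Γ : SimpleGraph V} {Δ : SimpleGraph W} (φ : Γ ≃g Δ)
    {K : Set V} (hK : Maximal Γ.IsClique K) : Maximal Δ.IsClique (φ '' K) := by
  refine ⟨?_, fun L hL hle => ?_⟩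
  · rintro _ ⟨x, hx, rfl⟩ _ ⟨y, hy, rfl⟩ hxy
    exact φ.map_adj_iff.2 (hK.1 hx hy fun h => hxy (h ▸ rfl))
  · have hL' : Γ.IsClique (φ ⁻¹' L) := fun x hx y hy hxy =>
      φ.map_adj_iff.1 (hL hx hy (φ.injective.ne hxy))
    rw [← φ.surjective.image_preimage L]
    exact Set.image_mono (hK.2 hL' (Set.image_subset_iff.1 hle))

theorem AreCloseAt.of_image {V W : Type*} {Γ : SimpleGraph V} {Δ : SimpleGraph W} (φ : Γ ≃g Δ)
    {u : V} {A B : Set V} (h : AreCloseAt Δ (φ u) (φ '' A) (φ '' B)) : AreCloseAt Γ u A B := by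
  obtain ⟨_, ⟨p, hp, rfl⟩, _, ⟨q, hq, rfl⟩, hpu, hqu, h⟩ := h
  exact ⟨p, hp, q, hq, fun h => hpu (h ▸ rfl), fun h => hqu (h ▸ rfl),
    h.imp (fun h => φ.injective h) φ.map_adj_iff.1⟩

theorem exists_pair_ne_of_five_le_card {ι : Type*} (h : 5 ≤ ENat.card ι) (i j : ι) :
    ∃ k l, k ≠ l ∧ i ≠ k ∧ i ≠ l ∧ j ≠ k ∧ j ≠ l := by
  have h1 : 1 < ({i, j}ᶜ : Set ι).encard := by
    by_contra! hle
    have hcard := Set.encard_add_encard_compl ({i, j} : Set ι)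
    rw [Set.encard_univ] at hcard
    have h2 : ({i, j} : Set ι).encard ≤ 1 + 1 := by
      simpa using Set.encard_insert_le {j} i
    have := h.trans (hcard.symm.le.trans (add_le_add h2 hle))
    norm_num at this
  obtain ⟨k, l, hk, hl, hkl⟩ := Set.one_lt_encard_iff.1 h1
  exact ⟨k, l, hkl, by grind⟩

section LinePreservation

variable {ι G H : Type*} {C : Set (ι → G)} {D : Set (ι → H)}

/-- The isomorphism `φ` of code graphs maps lines onto lines. -/
def PreservesLines (φ : codeGraph C ≃g codeGraph D) : Prop :=
  ∀ (u : C) (i j : ι), i ≠ j → ∃ a b, a ≠ b ∧ φ '' codeFlat u {i, j} = codeFlat (φ u) {a, b}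

namespace IsLatinCode

theorem image_codeFlat_eq (hC : IsLatinCode C) (hD : IsLatinCode D) (hG : 5 ≤ ENat.card G)
    (φ : codeGraph C ≃g codeGraph D) (u : C) {i j : ι} (hij : i ≠ j) :
    (∃ a b, a ≠ b ∧ φ '' codeFlat u {i, j} = codeFlat (φ u) {a, b}) ∨
      5 ≤ ENat.card ι ∧ ∃ w a, φ '' codeFlat u {i, j} = codeStar D w ∧
        ∀ k, (φ u).1 k ≠ w k ↔ k = a := by
  have hmax := maximal_isClique_image φ
    (hC.maximal_isClique_codeFlat (le_trans (by norm_num) hG) u hij)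
  have hcard : 5 ≤ (φ '' codeFlat u {i, j}).encard := by
    rwa [φ.injective.encard_image, hC.encard_codeFlat u hij]
  have hφu : φ u ∈ φ '' codeFlat u {i, j} := ⟨u, mem_codeFlat_self u _, rfl⟩
  rcases hD.subset_codeFlat_or_subset_codeStar hmax.1 hcard with ⟨p, a, b, hab, h⟩ | ⟨w, h⟩
  · rw [← codeFlat_eq_of_mem (h hφu)] at h
    exact Or.inl ⟨a, b, hab, h.antisymm (hmax.2 (hD.isClique_codeFlat _ hab) h)⟩
  · have heq : φ '' codeFlat u {i, j} = codeStar D w :=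
      h.antisymm (hmax.2 (fun x hx y hy hxy => hD.adj_of_mem_codeStar hx hy hxy) h)
    rw [heq] at hcard hφu
    obtain ⟨x, hx, hxu⟩ := Set.exists_ne_of_one_lt_encard (lt_of_lt_of_le (by norm_num) hcard) (φ u)
    obtain ⟨a, ha⟩ := hD.ne_iff_of_mem_codeStar hφu hx hxu.symm
    exact Or.inr ⟨hcard.trans (hD.encard_codeStar_le w), w, a, heq, ha⟩

theorem preservesLines (hC : IsLatinCode C) (hD : IsLatinCode D) (hG : 5 ≤ ENat.card G)
    (φ : codeGraph C ≃g codeGraph D) : PreservesLines φ := by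
  intro u i j hij
  refine (hC.image_codeFlat_eq hD hG φ u hij).resolve_right ?_
  rintro ⟨hι, w, a, hw, ha⟩
  obtain ⟨k, l, hkl, hik, hil, hjk, hjl⟩ := exists_pair_ne_of_five_le_card hι i j
  have : Nontrivial ι := ⟨i, j, hij⟩
  refine hC.not_areCloseAt_codeFlat hij hik hil hjk hjl (u := u) (AreCloseAt.of_image φ ?_)
  rw [hw]
  obtain ⟨b, c, hbc, h⟩ | ⟨-, w', b, h, hb⟩ := hC.image_codeFlat_eq hD hG φ u hkl
  · exact h ▸ hD.areCloseAt_codeStar_codeFlat hbc ha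
  · exact h ▸ hD.areCloseAt_codeStar_codeStar ha hb

theorem pair_eq_of_mem (hC : IsLatinCode C) {u v : C} {a b c d : ι} (huv : v ≠ u)
    (h : v ∈ codeFlat u {a, b}) (h' : v ∈ codeFlat u {c, d}) : ({a, b} : Set ι) = {c, d} :=
  Set.ext fun k =>
    (hC.ne_iff_of_mem_codeFlat h huv k).symm.trans (hC.ne_iff_of_mem_codeFlat h' huv k)

theorem ne_of_mem_codeFlat (hC : IsLatinCode C) {u v : C} {a b : ι} (hv : v ∈ codeFlat u {a, b})
    (hvu : v ≠ u) : a ≠ b := by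
  rintro rfl
  exact hvu (hC.eq_of_forall_ne a fun k hk => mem_codeFlat_pair.1 hv k hk hk)

theorem letter_eq_of_adj (hC : IsLatinCode C) {u v w : C} {a b c : ι} (hbc : b ≠ c)
    (hv : v ∈ codeFlat u {a, b}) (hw : w ∈ codeFlat u {a, c}) (hvu : v ≠ u) (hwu : w ≠ u)
    (h : (codeGraph C).Adj v w) : v.1 a = w.1 a := by
  by_contra hne
  have hv' := hC.ne_iff_of_mem_codeFlat hv hvu
  have hw' := hC.ne_iff_of_mem_codeFlat hw hwu
  exact not_adj_of_ne_of_ne_of_ne (hC.ne_of_mem_codeFlat hv hvu) (hC.ne_of_mem_codeFlat hw hwu) hbc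
    (Ne.symm hne) (by grind) (by grind) h

end IsLatinCode

/-- The isomorphism `φ` maps the plane through `u` with directions `σ` onto the plane through `φ u`
with directions `τ`, in such a way that lines through `u` with directions `σ r`, `σ s` go to lines
with directions `τ r`, `τ s`. -/
def MapsPlane (φ : codeGraph C ≃g codeGraph D) (u : C) (σ τ : Fin 3 ↪ ι) : Prop :=
  ∀ r s, r ≠ s → φ '' codeFlat u {σ r, σ s} = codeFlat (φ u) {τ r, τ s}

theorem exists_third_index (r s : Fin 3) (hrs : r ≠ s) :
    ∃ t, t ≠ r ∧ t ≠ s ∧ ∀ k, k ≠ t → k = r ∨ k = s := by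
  decide +revert

theorem exists_other_indices (t : Fin 3) :
    ∃ r s, r ≠ s ∧ t ≠ r ∧ t ≠ s ∧ ∀ k, k ≠ t → k = r ∨ k = s := by
  decide +revert

theorem ne_add_one (t : Fin 3) : t ≠ t + 1 := by
  decide +revert

theorem mem_codeFlat_pair_of_range {u v : C} {σ : Fin 3 ↪ ι} {r s t : Fin 3}
    (ht : ∀ k, k ≠ t → k = r ∨ k = s) (hv : v ∈ codeFlat u (Set.range σ))
    (h : v.1 (σ t) = u.1 (σ t)) : v ∈ codeFlat u {σ r, σ s} := by
  refine mem_codeFlat_pair.2 fun k hkr hks => ?_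
  by_cases hk : k ∈ Set.range σ
  · obtain ⟨t', rfl⟩ := hk
    obtain rfl : t' = t := by_contra fun ht' =>
      (ht t' ht').elim (fun h => hkr (h ▸ rfl)) fun h => hks (h ▸ rfl)
    exact h
  · exact hv k hk

theorem pair_subset_range (σ : Fin 3 ↪ ι) (r s : Fin 3) : {σ r, σ s} ⊆ Set.range σ := by
  rintro _ (rfl | rfl) <;> exact Set.mem_range_self _

theorem IsLatinCode.exists_transversal (hC : IsLatinCode C) {u p : C} {σ : Fin 3 ↪ ι}
    {r s t : Fin 3} (hrs : r ≠ s) (htr : t ≠ r) (hts : t ≠ s) (ht : ∀ k, k ≠ t → k = r ∨ k = s)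
    (hp : p ∈ codeFlat u (Set.range σ)) (hpt : p.1 (σ t) ≠ u.1 (σ t)) :
    ∃ v w, v ∈ codeFlat u {σ t, σ r} ∧ w ∈ codeFlat u {σ t, σ s} ∧ v ≠ u ∧ w ≠ u ∧ v ≠ w ∧
      v ∈ codeFlat p {σ r, σ s} ∧ w ∈ codeFlat p {σ r, σ s} := by
  obtain ⟨v, hv, hvt⟩ := hC.exists_mem_codeFlat u (σ.injective.ne htr) (p.1 (σ t))
  obtain ⟨w, hw, hwt⟩ := hC.exists_mem_codeFlat u (σ.injective.ne hts) (p.1 (σ t))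
  have hvu : v ≠ u := by grind
  refine ⟨v, w, hv, hw, hvu, by grind, ?_, ?_, ?_⟩
  · rintro rfl
    exact (hC.ne_iff_of_mem_codeFlat hv hvu (σ r)).2 (Or.inr rfl)
      (mem_codeFlat_pair.1 hw _ (σ.injective.ne htr.symm) (σ.injective.ne hrs))
  · exact mem_codeFlat_pair_of_range ht
      (codeFlat_eq_of_mem hp ▸ codeFlat_mono u (pair_subset_range σ t r) hv) hvt
  · exact mem_codeFlat_pair_of_range ht
      (codeFlat_eq_of_mem hp ▸ codeFlat_mono u (pair_subset_range σ t s) hw) hwt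

namespace MapsPlane

variable {φ : codeGraph C ≃g codeGraph D} {u : C} {σ τ : Fin 3 ↪ ι}

theorem map_mem_codeFlat (h : MapsPlane φ u σ τ) {p : C} {r s : Fin 3} (hrs : r ≠ s)
    (hp : p ∈ codeFlat u {σ r, σ s}) : φ p ∈ codeFlat (φ u) {τ r, τ s} :=
  h r s hrs ▸ Set.mem_image_of_mem φ hp

/-- If `p` is off the line in direction `r`, `s` through `u`, then the line in this direction
through `p` meets the two other lines through `u`, in adjacent points `v` and `w`; the images of
`v` and `w` are adjacent points on distinct lines, so they determine the direction of the image. -/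
theorem image_codeFlat_of_mem (h : MapsPlane φ u σ τ) (hC : IsLatinCode C) (hD : IsLatinCode D)
    (hφ : PreservesLines φ) {p : C} (hp : p ∈ codeFlat u (Set.range σ)) {r s : Fin 3}
    (hrs : r ≠ s) : φ '' codeFlat p {σ r, σ s} = codeFlat (φ p) {τ r, τ s} ∧
      φ p ∈ codeFlat (φ u) (Set.range τ) := by
  obtain ⟨t, htr, hts, ht⟩ := exists_third_index r s hrs
  by_cases hpt : p.1 (σ t) = u.1 (σ t)
  · have hp' := mem_codeFlat_pair_of_range ht hp hpt
    have hφp := h.map_mem_codeFlat hrs hp'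
    rw [codeFlat_eq_of_mem hp', codeFlat_eq_of_mem hφp]
    exact ⟨h r s hrs, codeFlat_mono _ (pair_subset_range τ r s) hφp⟩
  obtain ⟨v, w, hv, hw, hvu, hwu, hvw, hvp, hwp⟩ := hC.exists_transversal hrs htr hts ht hp hpt
  have hφv := h.map_mem_codeFlat htr hv
  have hφw := h.map_mem_codeFlat hts hw
  have hφvw : φ v ∈ codeFlat (φ w) {τ r, τ s} := by
    have := hD.letter_eq_of_adj (τ.injective.ne hrs) hφv hφw (φ.injective.ne hvu)
      (φ.injective.ne hwu)
      (φ.map_adj_iff.2 (hC.isClique_codeFlat p (σ.injective.ne hrs) hvp hwp hvw))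
    simp only [mem_codeFlat_pair] at hφv hφw ⊢
    intro k hkr hks
    by_cases hkt : k = τ t
    · exact hkt ▸ this
    · exact (hφv k hkt hkr).trans (hφw k hkt hks).symm
  obtain ⟨a, b, -, hab⟩ := hφ p (σ r) (σ s) (σ.injective.ne hrs)
  have hφvp : φ v ∈ codeFlat (φ p) {a, b} := hab ▸ Set.mem_image_of_mem φ hvp
  have hφwp : φ w ∈ codeFlat (φ p) {a, b} := hab ▸ Set.mem_image_of_mem φ hwp
  have hpair := hD.pair_eq_of_mem (φ.injective.ne hvw) (codeFlat_eq_of_mem hφwp ▸ hφvp) hφvw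
  rw [hpair] at hab hφvp
  refine ⟨hab, ?_⟩
  have hplane := codeFlat_mono _ (pair_subset_range τ r s) hφvp
  rw [← codeFlat_eq_of_mem (codeFlat_mono _ (pair_subset_range τ t r) hφv),
    codeFlat_eq_of_mem hplane]
  exact mem_codeFlat_self _ _

theorem letter_eq (h : MapsPlane φ u σ τ) (hC : IsLatinCode C) (hD : IsLatinCode D)
    (hφ : PreservesLines φ) {p q : C} (hp : p ∈ codeFlat u (Set.range σ))
    (hq : q ∈ codeFlat u (Set.range σ)) {t : Fin 3} (hpq : q.1 (σ t) = p.1 (σ t)) :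
    (φ q).1 (τ t) = (φ p).1 (τ t) := by
  obtain ⟨r, s, hrs, htr, hts, ht⟩ := exists_other_indices t
  have hqp := mem_codeFlat_pair_of_range ht (codeFlat_eq_of_mem hp ▸ hq) hpq
  have hφ := (h.image_codeFlat_of_mem hC hD hφ hp hrs).1 ▸ Set.mem_image_of_mem φ hqp
  exact mem_codeFlat_pair.1 hφ _ (τ.injective.ne htr) (τ.injective.ne hts)

theorem exists_bijective_letters (h : MapsPlane φ u σ τ) (hC : IsLatinCode C) (hD : IsLatinCode D)
    (hφ : PreservesLines φ) : ∃ f : Fin 3 → G → H, (∀ t, Function.Bijective (f t)) ∧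
      ∀ p ∈ codeFlat u (Set.range σ), φ p ∈ codeFlat (φ u) (Set.range τ) ∧
        ∀ t, (φ p).1 (τ t) = f t (p.1 (σ t)) := by
  have hσ (t : Fin 3) : σ t ≠ σ (t + 1) := σ.injective.ne (ne_add_one t)
  choose q hq hqt using fun t x => hC.exists_mem_codeFlat u (hσ t) x
  have hq' (t : Fin 3) (x : G) := codeFlat_mono u (pair_subset_range σ t (t + 1)) (hq t x)
  have hletter (p : C) (hp : p ∈ codeFlat u (Set.range σ)) (t : Fin 3) :
      (φ p).1 (τ t) = (φ (q t (p.1 (σ t)))).1 (τ t) :=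
    h.letter_eq hC hD hφ (hq' t _) hp (hqt t _).symm
  refine ⟨fun t x => (φ (q t x)).1 (τ t), fun t => ⟨fun x y hxy => ?_, fun z => ?_⟩, fun p hp =>
    ⟨(h.image_codeFlat_of_mem hC hD hφ hp (r := 0) (s := 1) (by decide)).2, hletter p hp⟩⟩
  · have := hD.eq_of_mem_codeFlat (h.map_mem_codeFlat (ne_add_one t) (hq t x))
      (h.map_mem_codeFlat (ne_add_one t) (hq t y)) hxy
    rw [← hqt t x, φ.injective this, hqt t y]
  · obtain ⟨_, hw, rfl⟩ := hD.exists_mem_codeFlat (φ u) (τ.injective.ne (ne_add_one t)) z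
    rw [← h t (t + 1) (ne_add_one t)] at hw
    obtain ⟨p, hp, rfl⟩ := hw
    exact ⟨p.1 (σ t), (hletter p (codeFlat_mono u (pair_subset_range σ t (t + 1)) hp) t).symm⟩

end MapsPlane

theorem sunflower_or_triangle {a b c d e f : ι} (hab : a ≠ b) (hcd : c ≠ d) (hef : e ≠ f)
    (hAB : ({a, b} ∩ {c, d} : Set ι).Nonempty) (hBE : ({c, d} ∩ {e, f} : Set ι).Nonempty)
    (hEA : ({e, f} ∩ {a, b} : Set ι).Nonempty) (hAB' : ({a, b} : Set ι) ≠ {c, d})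
    (hBE' : ({c, d} : Set ι) ≠ {e, f}) (hEA' : ({e, f} : Set ι) ≠ {a, b}) :
    (∃ o p q r, p ≠ q ∧ q ≠ r ∧ r ≠ p ∧
      ({a, b} : Set ι) = {o, p} ∧ ({c, d} : Set ι) = {o, q} ∧ ({e, f} : Set ι) = {o, r}) ∨
    ∃ o p q, o ≠ p ∧ o ≠ q ∧ p ≠ q ∧
      ({a, b} : Set ι) = {o, p} ∧ ({c, d} : Set ι) = {o, q} ∧ ({e, f} : Set ι) = {p, q} := by
  have pair {s t o : ι} (hst : s ≠ t) (ho : o ∈ ({s, t} : Set ι)) :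
      ∃ p, o ≠ p ∧ ({s, t} : Set ι) = {o, p} := by
    rcases ho with rfl | rfl
    exacts [⟨t, hst, rfl⟩, ⟨s, hst.symm, Set.pair_comm _ _⟩]
  obtain ⟨o, hoA, hoB⟩ := hAB
  obtain ⟨p, hop, hA⟩ := pair hab hoA
  obtain ⟨q, hoq, hB⟩ := pair hcd hoB
  have hpq : p ≠ q := fun h => hAB' (by rw [hA, hB, h])
  rw [hA] at hEA hEA'
  rw [hB] at hBE hBE'
  by_cases ho : o ∈ ({e, f} : Set ι)
  · obtain ⟨r, -, hE⟩ := pair hef ho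
    rw [hE] at hBE' hEA'
    exact Or.inl ⟨o, p, q, r, hpq, fun h => hBE' (h ▸ rfl), fun h => hEA' (h ▸ rfl), hA, hB, hE⟩
  · have hpE : p ∈ ({e, f} : Set ι) := by
      obtain ⟨x, hx, rfl | rfl⟩ := hEA
      exacts [absurd hx ho, hx]
    have hqE : q ∈ ({e, f} : Set ι) := by
      obtain ⟨x, rfl | rfl, hx⟩ := hBE
      exacts [absurd hx ho, hx]
    obtain ⟨q', -, hE⟩ := pair hef hpE
    obtain rfl : q = q' := (hE ▸ hqE).resolve_left hpq.symm
    exact Or.inr ⟨o, p, q, hop, hoq, hpq, hA, hB, hE⟩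

namespace IsLatinCode

theorem inter_nonempty_of_adj (hC : IsLatinCode C) {u v w : C} {a b c d : ι}
    (hv : v ∈ codeFlat u {a, b}) (hw : w ∈ codeFlat u {c, d}) (hvu : v ≠ u) (hwu : w ≠ u)
    (hvw : (codeGraph C).Adj v w) : ({a, b} ∩ {c, d} : Set ι).Nonempty := by
  by_contra! h
  have hdisj (k : ι) (hk : k = a ∨ k = b) : k ≠ c ∧ k ≠ d := not_or.1 fun hk' =>
    Set.eq_empty_iff_forall_notMem.1 h k ⟨hk, hk'⟩
  exact hC.not_areCloseAt_codeFlat (hC.ne_of_mem_codeFlat hv hvu) (hdisj a (Or.inl rfl)).1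
    (hdisj a (Or.inl rfl)).2 (hdisj b (Or.inr rfl)).1 (hdisj b (Or.inr rfl)).2
    ⟨v, hv, w, hw, hvu, hwu, Or.inr hvw⟩

theorem exists_mapsPlane_of_image {φ : codeGraph C ≃g codeGraph D} {u : C} {σ : Fin 3 ↪ ι}
    {o x y : ι} (hox : o ≠ x) (hoy : o ≠ y) (hxy : x ≠ y)
    (h01 : φ '' codeFlat u {σ 0, σ 1} = codeFlat (φ u) {o, x})
    (h02 : φ '' codeFlat u {σ 0, σ 2} = codeFlat (φ u) {o, y})
    (h12 : φ '' codeFlat u {σ 1, σ 2} = codeFlat (φ u) {x, y}) : ∃ τ, MapsPlane φ u σ τ := by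
  have hinj : Function.Injective ![o, x, y] := by
    simp [Function.Injective, Fin.forall_fin_succ, hox, hoy, hxy, hox.symm, hoy.symm, hxy.symm]
  refine ⟨⟨![o, x, y], hinj⟩, fun t t' htt => ?_⟩
  wlog hlt : t < t' generalizing t t'
  · rw [Set.pair_comm, this t' t htt.symm (lt_of_le_of_ne (not_lt.1 hlt) htt.symm), Set.pair_comm]
  fin_cases t <;> fin_cases t' <;> first | assumption | exact absurd hlt (by decide)

/-- The images of the three lines visited by the walk `p`, `q`, `r`, `s` meet pairwise. If they had
a common direction, the four images would have the same letter there, which forces `p = s`. -/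
theorem exists_mapsPlane (hC : IsLatinCode C) (hD : IsLatinCode D) {φ : codeGraph C ≃g codeGraph D}
    (hφ : PreservesLines φ) {u p q r s : C} {σ : Fin 3 ↪ ι} (hp : p ∈ codeFlat u {σ 0, σ 1})
    (hq : q ∈ codeFlat u {σ 0, σ 2}) (hr : r ∈ codeFlat u {σ 1, σ 2})
    (hs : s ∈ codeFlat u {σ 0, σ 1}) (hpu : p ≠ u) (hqu : q ≠ u) (hru : r ≠ u) (hsu : s ≠ u)
    (hpq : (codeGraph C).Adj p q) (hqr : (codeGraph C).Adj q r) (hrs : (codeGraph C).Adj r s)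
    (hps : p ≠ s) : ∃ τ, MapsPlane φ u σ τ := by
  have hσ {a b : Fin 3} (h : a ≠ b) : σ a ≠ σ b := σ.injective.ne h
  obtain ⟨a, b, hab, hA⟩ := hφ u (σ 0) (σ 1) (hσ (by decide))
  obtain ⟨c, d, hcd, hB⟩ := hφ u (σ 0) (σ 2) (hσ (by decide))
  obtain ⟨e, f, hef, hE⟩ := hφ u (σ 1) (σ 2) (hσ (by decide))
  have hmem {v : C} {s s' : Set ι} (hs : φ '' codeFlat u s = codeFlat (φ u) s')
      (hv : v ∈ codeFlat u s) : φ v ∈ codeFlat (φ u) s' := hs ▸ Set.mem_image_of_mem φ hv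
  have hne {v : C} (hv : v ≠ u) : φ v ≠ φ u := φ.injective.ne hv
  have hadj {v w : C} (h : (codeGraph C).Adj v w) : (codeGraph D).Adj (φ v) (φ w) :=
    φ.map_adj_iff.2 h
  have hpair {v : C} {s' t' : Set ι} {i j k l : Fin 3} (hv : v ∈ codeFlat u {σ i, σ j})
      (hvu : v ≠ u) (hs : φ '' codeFlat u {σ i, σ j} = codeFlat (φ u) s')
      (ht : φ '' codeFlat u {σ k, σ l} = codeFlat (φ u) t') (h : s' = t') :
      i = k ∧ j = l ∨ i = l ∧ j = k := by
    rw [h, ← ht] at hs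
    have hkl : ({σ i, σ j} : Set ι) = {σ k, σ l} :=
      hC.pair_eq_of_mem hvu hv (φ.injective.image_injective hs ▸ hv)
    simpa only [Set.pair_eq_pair_iff, σ.injective.eq_iff] using hkl
  rcases sunflower_or_triangle hab hcd hef
      (hD.inter_nonempty_of_adj (hmem hA hp) (hmem hB hq) (hne hpu) (hne hqu) (hadj hpq))
      (hD.inter_nonempty_of_adj (hmem hB hq) (hmem hE hr) (hne hqu) (hne hru) (hadj hqr))
      (hD.inter_nonempty_of_adj (hmem hE hr) (hmem hA hs) (hne hru) (hne hsu) (hadj hrs))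
      (fun h => absurd (hpair hp hpu hA hB h) (by decide))
      (fun h => absurd (hpair hq hqu hB hE h) (by decide))
      (fun h => absurd (hpair hr hru hE hA h) (by decide))
    with ⟨o, x, y, z, hxy, hyz, hzx, hA', hB', hE'⟩ | ⟨o, x, y, hox, hoy, hxy, hA', hB', hE'⟩
  · rw [hA'] at hA
    rw [hB'] at hB
    rw [hE'] at hE
    have hletter : (φ p).1 o = (φ s).1 o :=
      ((hD.letter_eq_of_adj hxy (hmem hA hp) (hmem hB hq) (hne hpu) (hne hqu) (hadj hpq)).trans
        (hD.letter_eq_of_adj hyz (hmem hB hq) (hmem hE hr) (hne hqu) (hne hru) (hadj hqr))).trans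
        (hD.letter_eq_of_adj hzx (hmem hE hr) (hmem hA hs) (hne hru) (hne hsu) (hadj hrs))
    exact absurd (φ.injective (hD.eq_of_mem_codeFlat (hmem hA hp) (hmem hA hs) hletter)) hps
  · exact exists_mapsPlane_of_image hox hoy hxy (hA' ▸ hA) (hB' ▸ hB) (hE' ▸ hE)

end IsLatinCode

end LinePreservation

theorem IsLatinCode.adj_of_letter_eq {ι G : Type*} {C : Set (ι → G)} (hC : IsLatinCode C)
    {u v w : C} {a b c : ι} (hab : a ≠ b) (hbc : b ≠ c) (hv : v ∈ codeFlat u {a, b})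
    (hw : w ∈ codeFlat u {a, c}) (hvu : v ≠ u) (h : v.1 a = w.1 a) : (codeGraph C).Adj v w := by
  rw [mem_codeFlat_pair] at hw
  have hvw : v ≠ w := by
    rintro rfl
    exact (hC.ne_iff_of_mem_codeFlat hv hvu b).2 (Or.inr rfl) (hw b hab.symm hbc)
  rw [mem_codeFlat_pair] at hv
  refine hC.adj_of_mem_codeFlat hbc (mem_codeFlat_pair.2 fun k hkb hkc => ?_) hvw
  by_cases hka : k = a
  · exact hka ▸ h
  · rw [hv k hka hkb, hw k hka hkc]

section GroupCode

variable {G : Type*} [Group G] {n : ℕ}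

/-- The code of the words of length `n` over a group whose letters have product one. -/
def groupCode (G : Type*) [Group G] (n : ℕ) : Set (Fin n → G) := {d | (List.ofFn d).prod = 1}

instance : One (groupCode G n) := ⟨1, by simp [groupCode, Pi.one_def]⟩

theorem prod_ofFn_update (w : Fin n → G) (i : Fin n) (x : G) :
    (List.ofFn (Function.update w i x)).prod =
      ((List.ofFn w).take i).prod * x * ((List.ofFn w).drop (i + 1)).prod := by
  have h : List.ofFn (Function.update w i x) = (List.ofFn w).set i x := by
    refine List.ext_getElem (by simp) fun k hk _ => ?_
    simp [List.getElem_set, Function.update_apply, Fin.ext_iff, eq_comm]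
  simp [h, List.prod_set]

theorem isLatinCode_groupCode : IsLatinCode (groupCode G n) := by
  intro w i
  set a := ((List.ofFn w).take i).prod
  set b := ((List.ofFn w).drop (i + 1)).prod
  have hmem (x : G) : Function.update w i x ∈ groupCode G n ↔ x = a⁻¹ * b⁻¹ := by
    change (List.ofFn _).prod = 1 ↔ _
    rw [prod_ofFn_update, mul_eq_one_iff_eq_inv, ← eq_inv_mul_iff_mul_eq]
  refine ⟨⟨Function.update w i _, (hmem _).2 rfl⟩, fun k hk => Function.update_of_ne hk _ _, ?_⟩
  rintro ⟨v, hv⟩ hvw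
  have hv' : v = Function.update w i (v i) :=
    Function.eq_update_iff.2 ⟨rfl, hvw⟩
  have hx : v i = a⁻¹ * b⁻¹ := by rwa [hv', hmem] at hv
  exact Subtype.ext (hv'.trans (by rw [hx]))

theorem prod_ofFn_eq_prod_map {l : List (Fin n)} (hl : l.SortedLT) {w : Fin n → G}
    (hw : ∀ k ∉ l, w k = 1) : (List.ofFn w).prod = (l.map w).prod := by
  have hfilter (L : List (Fin n)) : (L.map w).prod = ((L.filter (· ∈ l)).map w).prod := by
    induction L with
    | nil => rfl
    | cons k L ih => by_cases hk : k ∈ l <;> simp [hk, ih, hw]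
  have hl' : (List.finRange n).filter (· ∈ l) = l :=
    ((List.sortedLT_finRange n).pairwise.filter _).sortedLT.eq_of_mem_iff hl (by simp)
  rw [List.ofFn_eq_map, hfilter, hl']

theorem mul_eq_one_of_mem_codeFlat {p : groupCode G n} {i j : Fin n} (hij : i ≠ j)
    (hp : p ∈ codeFlat 1 {i, j}) : p.1 i * p.1 j = 1 := by
  wlog hlt : i < j generalizing i j
  · exact mul_eq_one_comm.1 (this hij.symm (Set.pair_comm i j ▸ hp)
      (lt_of_le_of_ne (not_lt.1 hlt) hij.symm))
  have := prod_ofFn_eq_prod_map (l := [i, j]) (w := p.1)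
    (List.Pairwise.sortedLT (by simpa using hlt)) fun k hk => hp k (by simpa using hk)
  simpa using this.symm.trans p.2

theorem mul_mul_eq_one_of_mem_codeFlat {p : groupCode G n} {i j k : Fin n} (hij : i < j)
    (hjk : j < k) (hp : p ∈ codeFlat 1 {i, j, k}) : p.1 i * p.1 j * p.1 k = 1 := by
  have := prod_ofFn_eq_prod_map (l := [i, j, k]) (w := p.1)
    (List.Pairwise.sortedLT (by simp [hij, hjk, hij.trans hjk])) fun l hl =>
      hp l (by simpa using hl)
  simpa [mul_assoc] using this.symm.trans p.2

theorem mul_mul_eq_one_rotate {x y z : G} : x * y * z = 1 ↔ y * z * x = 1 := by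
  rw [mul_assoc, mul_eq_one_comm]

/-- Up to a cyclic rotation, which does not affect whether a product is one, the three positions
are either increasing or decreasing. -/
theorem mul_mul_eq_one_or_of_ne {s : Set (Fin n)} {i j k : Fin n} (hs : s = {i, j, k}) (hij : i ≠ j)
    (hjk : j ≠ k) (hki : k ≠ i) :
    (∀ p : groupCode G n, p ∈ codeFlat 1 s → p.1 i * p.1 j * p.1 k = 1) ∨
      ∀ p : groupCode G n, p ∈ codeFlat 1 s → p.1 k * p.1 j * p.1 i = 1 := by
  wlog hi : i < j ∧ i < k generalizing i j k
  · obtain hj | hk : j < k ∧ j < i ∨ k < i ∧ k < j := by grind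
    · exact (this (by grind) hjk hki hij hj).imp
        (fun h p hp => mul_mul_eq_one_rotate.2 (h p hp))
        (fun h p hp => mul_mul_eq_one_rotate.1 (h p hp))
    · exact (this (by grind) hki hij hjk hk).imp
        (fun h p hp => mul_mul_eq_one_rotate.1 (h p hp))
        (fun h p hp => mul_mul_eq_one_rotate.2 (h p hp))
  subst hs
  obtain hlt | hlt := lt_or_gt_of_ne hjk
  · exact Or.inl fun p => mul_mul_eq_one_of_mem_codeFlat hi.1 hlt
  · exact Or.inr fun p hp => mul_mul_eq_one_rotate.1
      (mul_mul_eq_one_of_mem_codeFlat hi.2 hlt (Set.pair_comm j k ▸ hp))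

end GroupCode

section GroupRecovery

variable {G H : Type*} [Group G] [Group H] {n : ℕ}
  {φ : codeGraph (groupCode G n) ≃g codeGraph (groupCode H n)} {σ τ : Fin 3 ↪ Fin n}

theorem exists_mem_codeFlat_groupCode {i j : Fin n} (hij : i ≠ j) (x : G) :
    ∃ p : groupCode G n, p ∈ codeFlat 1 {i, j} ∧ p.1 i = x ∧ p.1 j = x⁻¹ := by
  obtain ⟨p, hp, hpi⟩ := isLatinCode_groupCode.exists_mem_codeFlat (1 : groupCode G n) hij x
  exact ⟨p, hp, hpi, hpi ▸ eq_inv_of_mul_eq_one_right (mul_eq_one_of_mem_codeFlat hij hp)⟩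

theorem exists_mapsPlane_groupCode (hφ : PreservesLines φ) (σ : Fin 3 ↪ Fin n) {x : G}
    (hx : x * x ≠ 1) : ∃ τ, MapsPlane φ 1 σ τ := by
  have h01 : σ 0 ≠ σ 1 := σ.injective.ne (by decide)
  have h02 : σ 0 ≠ σ 2 := σ.injective.ne (by decide)
  have h12 : σ 1 ≠ σ 2 := σ.injective.ne (by decide)
  obtain ⟨p, hp, hp0, hp1⟩ := exists_mem_codeFlat_groupCode h01 x
  obtain ⟨q, hq, hq0, hq2⟩ := exists_mem_codeFlat_groupCode h02 x
  obtain ⟨r, hr, hr1, hr2⟩ := exists_mem_codeFlat_groupCode h12 x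
  obtain ⟨s, hs, hs1, hs0⟩ := exists_mem_codeFlat_groupCode h01.symm x
  have hx1 : x ≠ 1 := by
    rintro rfl
    exact hx (one_mul 1)
  have hne {v : groupCode G n} {k : Fin n} (hv : v.1 k = x) : v ≠ 1 := fun h => hx1 (h ▸ hv).symm
  have hps : p ≠ s := by
    rintro rfl
    exact hx (mul_eq_one_iff_eq_inv.2 (hp0.symm.trans hs0))
  have hL := isLatinCode_groupCode (G := G) (n := n)
  exact hL.exists_mapsPlane isLatinCode_groupCode hφ hp hq hr (Set.pair_comm (σ 0) (σ 1) ▸ hs)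
    (hne hp0) (hne hq0) (hne hr1) (hne hs1)
    (hL.adj_of_letter_eq h01 h12 hp hq (hne hp0) (hp0.trans hq0.symm))
    (hL.adj_of_letter_eq h02.symm h01 (Set.pair_comm (σ 0) (σ 2) ▸ hq)
      (Set.pair_comm (σ 1) (σ 2) ▸ hr) (hne hq0) (hq2.trans hr2.symm))
    (hL.adj_of_letter_eq h12 h02.symm hr hs (hne hr1) (hr1.trans hs1.symm)) hps

theorem map_mul_of_homotopy {M N : Type*} [MulOneClass M] [MulOneClass N] {f g k : M → N}
    (hf : f 1 = 1) (hg : g 1 = 1) (h : ∀ x y, f x * g y = k (x * y)) (x y : M) :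
    f (x * y) = f x * f y := by
  have hfk (x : M) : f x = k x := by simpa [hg] using h x 1
  have hgk (y : M) : g y = k y := by simpa [hf] using h 1 y
  rw [hfk, ← h, hgk, hfk y]

theorem nonempty_mulEquiv_of_homotopy {f g k : G → H} (hbij : Function.Bijective f)
    (hf : f 1 = 1) (hg : g 1 = 1) (h : ∀ x y, f x * g y = k (x * y)) : Nonempty (G ≃* H) :=
  ⟨.ofBijective (MonoidHom.mk' f (map_mul_of_homotopy hf hg h)) hbij⟩

theorem range_fin_three {α : Type*} (f : Fin 3 → α) : Set.range f = {f 0, f 1, f 2} := by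
  ext a
  simp [Fin.exists_fin_succ, eq_comm]

theorem exists_mem_plane_groupCode (hσ : StrictMono σ) (x y : G) :
    ∃ p : groupCode G n, p ∈ codeFlat 1 (Set.range σ) ∧ p.1 (σ 0) = x ∧ p.1 (σ 1) = y ∧
      p.1 (σ 2) = (x * y)⁻¹ := by
  have h01 : σ 0 < σ 1 := hσ (by decide)
  have h12 : σ 1 < σ 2 := hσ (by decide)
  obtain ⟨p, hp, -⟩ := isLatinCode_groupCode
    (Function.update (Function.update (1 : Fin n → G) (σ 0) x) (σ 1) y) (σ 2)
  have hp0 : p.1 (σ 0) = x := by simp [hp _ (h01.trans h12).ne, h01.ne]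
  have hp1 : p.1 (σ 1) = y := by simp [hp _ h12.ne]
  have hplane : p ∈ codeFlat 1 (Set.range σ) := fun k hk => by
    simp only [range_fin_three, Set.mem_insert_iff, Set.mem_singleton_iff, not_or] at hk
    rw [hp k hk.2.2, Function.update_of_ne hk.2.1, Function.update_of_ne hk.1]
    rfl
  refine ⟨p, hplane, hp0, hp1, ?_⟩
  rw [← hp0, ← hp1]
  exact eq_inv_of_mul_eq_one_right
    (mul_mul_eq_one_of_mem_codeFlat h01 h12 (range_fin_three σ ▸ hplane))

theorem nonempty_mulEquiv_of_mapsPlane (hφ : PreservesLines φ) (hφ1 : φ 1 = 1) (hσ : StrictMono σ)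
    (h : MapsPlane φ 1 σ τ) : Nonempty (G ≃* H) := by
  obtain ⟨f, hf, hletter⟩ :=
    h.exists_bijective_letters isLatinCode_groupCode isLatinCode_groupCode hφ
  rw [hφ1] at hletter
  have hone (t : Fin 3) : f t 1 = 1 := by
    have := (hletter 1 (mem_codeFlat_self _ _)).2 t
    rwa [hφ1, eq_comm] at this
  choose p hp hp0 hp1 hp2 using exists_mem_plane_groupCode (G := G) hσ
  have hf0 (x y : G) : (φ (p x y)).1 (τ 0) = f 0 x :=
    ((hletter _ (hp x y)).2 0).trans (congrArg (f 0) (hp0 x y))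
  have hf1 (x y : G) : (φ (p x y)).1 (τ 1) = f 1 y :=
    ((hletter _ (hp x y)).2 1).trans (congrArg (f 1) (hp1 x y))
  have hf2 (x y : G) : (φ (p x y)).1 (τ 2) = f 2 (x * y)⁻¹ :=
    ((hletter _ (hp x y)).2 2).trans (congrArg (f 2) (hp2 x y))
  have hτ {r s : Fin 3} (hrs : r ≠ s) : τ r ≠ τ s := τ.injective.ne hrs
  obtain hprod | hprod := mul_mul_eq_one_or_of_ne (G := H) (range_fin_three τ) (hτ (by decide))
    (hτ (by decide)) (hτ (by decide))
  · refine nonempty_mulEquiv_of_homotopy (k := fun z => (f 2 z⁻¹)⁻¹) (hf 0) (hone 0) (hone 1)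
      fun x y => ?_
    rw [← hf0 x y, ← hf1 x y, ← hf2]
    exact eq_inv_of_mul_eq_one_left (hprod _ (hletter _ (hp x y)).1)
  · refine nonempty_mulEquiv_of_homotopy (f := fun x => (f 0 x)⁻¹) (g := fun y => (f 1 y)⁻¹)
      (k := fun z => f 2 z⁻¹) ((Equiv.inv H).bijective.comp (hf 0)) (by simp [hone])
      (by simp [hone]) fun x y => ?_
    rw [← hf0 x y, ← hf1 x y, ← hf2, ← mul_inv_rev, eq_comm, ← mul_eq_one_iff_eq_inv,
      ← mul_assoc]
    exact hprod _ (hletter _ (hp x y)).1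

end GroupRecovery

section Iso

variable {G : Type*} [Group G] {m : ℕ}

/-- The tuple `(1, g 0, …, g (m - 1), 1)`. -/
def padded {α : Type*} [One α] (g : Fin m → α) : Fin (m + 2) → α :=
  Fin.cons 1 (Fin.snoc g 1 : Fin (m + 1) → α)

theorem padded_zero (g : Fin m → G) : padded g 0 = 1 := rfl

theorem padded_last (g : Fin m → G) : padded g (Fin.last (m + 1)) = 1 := by
  rw [← Fin.succ_last, padded, Fin.cons_succ, Fin.snoc_last]

theorem padded_succ_castSucc (g : Fin m → G) (i : Fin m) : padded g i.succ.castSucc = g i := by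
  rw [← Fin.succ_castSucc, padded, Fin.cons_succ, Fin.snoc_castSucc]

theorem padded_div (g h : Fin m → G) (t : Fin (m + 2)) :
    padded (h * g⁻¹) t = padded h t * (padded g t)⁻¹ := by
  cases t using Fin.cases with
  | zero => simp only [padded_zero, inv_one, mul_one]
  | succ t => cases t using Fin.lastCases with
    | last => simp only [Fin.succ_last, padded_last, inv_one, mul_one]
    | cast t =>
      simp only [Fin.succ_castSucc, padded_succ_castSucc, Pi.mul_apply, Pi.inv_apply]

theorem padded_intervalElem {x : G} {k l : ℕ} (hk : 1 ≤ k) (hl : l ≤ m + 1) (t : Fin (m + 2)) :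
    padded (intervalElem m x k l) t = if k ≤ t ∧ t < l then x else 1 := by
  cases t using Fin.cases with
  | zero => simp [padded_zero]; omega
  | succ t => cases t using Fin.lastCases with
    | last => simp [padded_last]; omega
    | cast t => rw [Fin.succ_castSucc, padded_succ_castSucc]; simp [intervalElem]

theorem eq_ite_of_forall_eq {α : Type*} {n : ℕ} {e : Fin (n + 1) → α} {i j : Fin n} (hij : i < j)
    (h : ∀ k, k ≠ i → k ≠ j → e k.castSucc = e k.succ) (t : Fin (n + 1)) :
    e t = if (t : ℕ) ≤ i then e 0 else if (t : ℕ) ≤ j then e i.succ else e (Fin.last n) := by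
  have key (t : Fin (n + 1)) :
      e t = if (t : ℕ) ≤ i then e 0 else if (t : ℕ) ≤ j then e i.succ else e j.succ := by
    induction t using Fin.induction with
    | zero => simp
    | succ t ih => grind [Fin.val_castSucc]
  rw [key t, key (Fin.last n)]
  simp only [Fin.val_last]
  grind

theorem mem_intervalSet_iff {s : Fin m → G} : s ∈ intervalSet G m ↔
    ∃ i j : Fin (m + 1), i ≠ j ∧ ∀ k, padded s k.castSucc ≠ padded s k.succ ↔ k = i ∨ k = j := by
  constructor
  · rintro ⟨x, k, l, hx, hk, hkl, hl, rfl⟩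
    refine ⟨⟨k - 1, by omega⟩, ⟨l - 1, by omega⟩, by grind, fun t => ?_⟩
    simp only [padded_intervalElem hk hl, Fin.ext_iff, Fin.val_castSucc, Fin.val_succ]
    grind
  · rintro ⟨i, j, hij, h⟩
    wlog hlt : i < j generalizing i j
    · exact this j i hij.symm (fun k => (h k).trans or_comm) (by grind)
    have hs := eq_ite_of_forall_eq (e := padded s) hlt fun k hki hkj => by grind
    refine ⟨padded s i.succ, i + 1, j + 1, ?_, by omega, by grind, by omega, ?_⟩
    · have := (h i).2 (Or.inl rfl)
      grind [padded_zero]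
    · funext t
      rw [← padded_succ_castSucc s, hs]
      grind [padded_zero, padded_last, intervalElem]

theorem mem_groupCode_iff {n : ℕ} {d : Fin n → G} :
    d ∈ groupCode G n ↔ Fin.partialProd d (Fin.last n) = 1 := by
  rw [Fin.partialProd, Fin.val_last, List.take_of_length_le (List.length_ofFn (f := d)).le]
  rfl

theorem partialProd_padded (g : Fin m → G) :
    Fin.partialProd (fun k => (padded g k.castSucc)⁻¹ * padded g k.succ) = padded g := by
  simpa [padded_zero] using Fin.partialProd_left_inv (padded g)

theorem padded_partialProd (d : groupCode G (m + 1)) :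
    padded (fun i => Fin.partialProd d.1 i.succ.castSucc) = Fin.partialProd d.1 := by
  funext t
  cases t using Fin.cases with
  | zero => simp only [padded_zero, Fin.partialProd_zero]
  | succ t => cases t using Fin.lastCases with
    | last => exact (padded_last _).trans (mem_groupCode_iff.1 d.2).symm
    | cast t => rw [Fin.succ_castSucc, padded_succ_castSucc]

/-- A codeword corresponds to the tuple of its proper partial products. -/
def groupCodeEquiv (G : Type*) [Group G] (m : ℕ) : groupCode G (m + 1) ≃ (Fin m → G) where
  toFun d i := Fin.partialProd d.1 i.succ.castSucc
  invFun g := ⟨fun k => (padded g k.castSucc)⁻¹ * padded g k.succ,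
    mem_groupCode_iff.2 (by rw [partialProd_padded, padded_last])⟩
  left_inv d := Subtype.ext (by simp only [padded_partialProd, Fin.partialProd_right_inv])
  right_inv g := funext fun i => by
    simp only [partialProd_padded, padded_succ_castSucc]

/-- The jumps of the quotient of two tuples are at the positions where the codewords differ. -/
def codeGraphIso (G : Type*) [Group G] (m : ℕ) :
    codeGraph (groupCode G (m + 1)) ≃g intervalCayGraph m G where
  toEquiv := groupCodeEquiv G m
  map_rel_iff' {d d'} := by
    have hadj (g h : Fin m → G) : (intervalCayGraph m G).Adj g h ↔ h * g⁻¹ ∈ intervalSet G m := by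
      simp only [intervalCayGraph, cayGraph, ← mul_inv_eq_iff_eq_mul, exists_eq_right']
    have hpad (d : groupCode G (m + 1)) : padded (groupCodeEquiv G m d) = Fin.partialProd d.1 :=
      padded_partialProd d
    rw [hadj, mem_intervalSet_iff]
    refine exists₂_congr fun i j => and_congr_right' (forall_congr' fun k => iff_congr ?_ Iff.rfl)
    rw [padded_div, padded_div, hpad, hpad, Fin.partialProd_succ, Fin.partialProd_succ,
      mul_inv_rev, mul_assoc, ne_eq, mul_right_inj, ← mul_assoc, right_eq_mul, mul_inv_eq_one,
      eq_comm]

/-- Right multiplication is an automorphism, since `𝒢_m(G)` is defined by left multiplication. -/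
def intervalCayGraphMulRight (t : Fin m → G) : intervalCayGraph m G ≃g intervalCayGraph m G where
  toEquiv := Equiv.mulRight t
  map_rel_iff' := by
    simp only [intervalCayGraph, cayGraph, Equiv.coe_mulRight, ← mul_assoc, mul_left_inj,
      implies_true]

theorem exists_codeGraph_iso {H : Type*} [Group H]
    (ψ : intervalCayGraph m G ≃g intervalCayGraph m H) :
    ∃ φ : codeGraph (groupCode G (m + 1)) ≃g codeGraph (groupCode H (m + 1)), φ 1 = 1 :=
  let g := ψ (codeGraphIso G m 1)
  ⟨(((codeGraphIso G m).trans ψ).trans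
      (intervalCayGraphMulRight (g⁻¹ * codeGraphIso H m 1))).trans (codeGraphIso H m).symm,
    (codeGraphIso H m).symm_apply_eq.2 (mul_inv_cancel_left g _)⟩

end Iso

/-- The colouring `c` does not distinguish adjacent vertices in `s`, so it is a colouring of the
connected components of the graph induced on `s`. -/
def IsConstOnAdj {V κ : Type*} (Γ : SimpleGraph V) (s : Set V) (c : V → κ) : Prop :=
  ∀ z ∈ s, ∀ w ∈ s, Γ.Adj z w → c z = c w

/-- The graph has an edge whose ends have a disconnected set of common neighbours, with at least
three connected components: these can be coloured with three colours, all of which occur. -/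
def HasTrisectedEdge {V : Type*} (Γ : SimpleGraph V) : Prop :=
  ∃ u v, Γ.Adj u v ∧ ∃ c : V → Fin 3, IsConstOnAdj Γ (Γ.commonNeighbors u v) c ∧
    ∀ t, ∃ z ∈ Γ.commonNeighbors u v, c z = t

theorem HasTrisectedEdge.of_iso {V W : Type*} {Γ : SimpleGraph V} {Δ : SimpleGraph W}
    (h : HasTrisectedEdge Γ) (φ : Γ ≃g Δ) : HasTrisectedEdge Δ := by
  obtain ⟨u, v, huv, c, hc, hsurj⟩ := h
  have hmem (z : V) : φ z ∈ Δ.commonNeighbors (φ u) (φ v) ↔ z ∈ Γ.commonNeighbors u v :=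
    and_congr φ.map_adj_iff φ.map_adj_iff
  refine ⟨φ u, φ v, φ.map_adj_iff.2 huv, c ∘ φ.symm, ?_, fun t => ?_⟩
  · intro z hz w hw hzw
    obtain ⟨z, rfl⟩ := φ.surjective z
    obtain ⟨w, rfl⟩ := φ.surjective w
    simpa using hc z ((hmem z).1 hz) w ((hmem w).1 hw) (φ.map_adj_iff.1 hzw)
  · obtain ⟨z, hz, hzt⟩ := hsurj t
    exact ⟨φ z, (hmem z).2 hz, by simpa using hzt⟩

theorem IsLatinCode.mem_commonNeighbors {ι G : Type*} {C : Set (ι → G)} (hC : IsLatinCode C)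
    {u v w : C} {a b c : ι} (hac : a ≠ c) (hbc : b ≠ c) (hv : v ∈ codeFlat u {a, b})
    (hw : w ∈ codeFlat u {a, c}) (hvu : v ≠ u) (h : v.1 a = w.1 a) :
    w ∈ (codeGraph C).commonNeighbors u v := by
  have hva := (hC.ne_iff_of_mem_codeFlat hv hvu a).2 (Or.inl rfl)
  have hwu : w ≠ u := by
    rintro rfl
    exact hva h
  exact ⟨(hC.adj_of_mem_codeFlat hac hw hwu).symm,
    hC.adj_of_letter_eq (hC.ne_of_mem_codeFlat hv hvu) hbc hv hw hvu h⟩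

section TrisectedEdge

variable {G : Type*} [Group G] {n : ℕ}

/-- A common neighbour with the same letter as `v` at `i` has the inverse of this letter at a third
position. If it is adjacent to `w`, then `w` cannot differ from it at all of these positions. -/
theorem letter_eq_of_adj_groupCode {v z w : groupCode G n} {i j : Fin n} (hij : i ≠ j)
    (hv : v ∈ codeFlat 1 {i, j}) (hvij : v.1 i ≠ v.1 j)
    (hz : z ∈ (codeGraph (groupCode G n)).commonNeighbors 1 v)
    (hw : w ∈ (codeGraph (groupCode G n)).commonNeighbors 1 v)
    (hzw : (codeGraph (groupCode G n)).Adj z w) (hzi : z.1 i = v.1 i) : w.1 i = v.1 i := by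
  obtain ⟨hz1, hzv⟩ : (codeGraph _).Adj 1 z ∧ (codeGraph _).Adj v z := hz
  obtain ⟨hw1, hwv⟩ : (codeGraph _).Adj 1 w ∧ (codeGraph _).Adj v w := hw
  have hC := isLatinCode_groupCode (G := G) (n := n)
  have hv1 : v ≠ 1 := by
    rintro rfl
    exact hvij rfl
  have hne := hC.ne_iff_of_mem_codeFlat hv hv1
  have hmul := mul_eq_one_of_mem_codeFlat hij hv
  by_contra hwi
  obtain ⟨l, hli, hlj, hzl⟩ : ∃ l, l ≠ i ∧ l ≠ j ∧ z ∈ codeFlat 1 {i, l} := by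
    obtain h | ⟨l, hli, hlj, h, -⟩ | ⟨l, hli, -, h, -⟩ := codeGraph_triangle hij hne hz1 hzv
    · exact absurd (hC.eq_of_mem_codeFlat h hv hzi) hzv.ne'
    · exact ⟨l, hli, hlj, h⟩
    · exact absurd (hzi.symm.trans (mem_codeFlat_pair.1 h i hij hli.symm)) ((hne i).2 (Or.inl rfl))
  have hzj : z.1 j = 1 := mem_codeFlat_pair.1 hzl j hij.symm hlj.symm
  have hzlj : z.1 l = v.1 j :=
    mul_left_cancel <| (hzi ▸ mul_eq_one_of_mem_codeFlat hli.symm hzl).trans hmul.symm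
  have hvj : v.1 j ≠ 1 := (hne j).2 (Or.inr rfl)
  obtain ⟨hwj, hwl⟩ : w.1 j ≠ 1 ∧ w.1 l ≠ v.1 j := by
    obtain h | ⟨-, -, -, -, h⟩ | ⟨p, -, hpj, h, h'⟩ := codeGraph_triangle hij hne hw1 hwv
    · have hwl : w.1 l = 1 := mem_codeFlat_pair.1 h l hli hlj
      exact ⟨(hC.ne_iff_of_mem_codeFlat h hw1.ne' j).2 (Or.inr rfl), hwl ▸ hvj.symm⟩
    · exact absurd h hwi
    · refine ⟨h' ▸ hvj, ?_⟩
      by_cases hlp : l = p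
      · have hwp := mul_eq_one_comm.1 (h' ▸ mul_eq_one_of_mem_codeFlat hpj.symm h)
        rwa [hlp, mul_right_cancel (hwp.trans hmul.symm)]
      · have hwl : w.1 l = 1 := mem_codeFlat_pair.1 h l hlj hlp
        exact hwl ▸ hvj.symm
  exact not_adj_of_ne_of_ne_of_ne hij hli.symm hlj.symm (hzi ▸ hwi) (hzj ▸ hwj) (hzlj ▸ hwl) hzw

theorem hasTrisectedEdge_of_mul_self_ne_one (hn : 3 ≤ n) {x : G} (hx : x * x ≠ 1) :
    HasTrisectedEdge (codeGraph (groupCode G n)) := by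
  classical
  let σ := Fin.castLEEmb hn
  have h01 : σ 0 ≠ σ 1 := σ.injective.ne (by decide)
  have h02 : σ 0 ≠ σ 2 := σ.injective.ne (by decide)
  have h12 : σ 1 ≠ σ 2 := σ.injective.ne (by decide)
  have hC := isLatinCode_groupCode (G := G) (n := n)
  have hxx : x ≠ x⁻¹ := fun h => hx (mul_eq_one_iff_eq_inv.2 h)
  have hx1 : x ≠ 1 := fun h => hxx (by rw [h, inv_one])
  obtain ⟨v, hv, hv0, hv1⟩ := exists_mem_codeFlat_groupCode h01 x
  have hv' : v ∈ codeFlat 1 {σ 1, σ 0} := Set.pair_comm (σ 0) (σ 1) ▸ hv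
  have hvne : v ≠ 1 := fun h => hx1 (h ▸ hv0).symm
  have hv01 : v.1 (σ 0) ≠ v.1 (σ 1) := hv0 ▸ hv1 ▸ hxx
  refine ⟨1, v, (hC.adj_of_mem_codeFlat h01 hv hvne).symm,
    fun z => if z.1 (σ 0) = x then 0 else if z.1 (σ 1) = x⁻¹ then 1 else 2,
    fun z hz w hw hzw => ?_, fun t => ?_⟩
  · have h0 : z.1 (σ 0) = x ↔ w.1 (σ 0) = x := hv0 ▸
      ⟨letter_eq_of_adj_groupCode h01 hv hv01 hz hw hzw,
        letter_eq_of_adj_groupCode h01 hv hv01 hw hz hzw.symm⟩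
    have h1 : z.1 (σ 1) = x⁻¹ ↔ w.1 (σ 1) = x⁻¹ := hv1 ▸
      ⟨letter_eq_of_adj_groupCode h01.symm hv' hv01.symm hz hw hzw,
        letter_eq_of_adj_groupCode h01.symm hv' hv01.symm hw hz hzw.symm⟩
    simp only [h0, h1]
  · fin_cases t
    · obtain ⟨p, hp, hp0, -⟩ := exists_mem_codeFlat_groupCode h02 x
      exact ⟨p, hC.mem_commonNeighbors h02 h12 hv hp hvne (hv0.trans hp0.symm), if_pos hp0⟩
    · obtain ⟨p, hp, hp1, -⟩ := exists_mem_codeFlat_groupCode h12 x⁻¹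
      have hp0 : p.1 (σ 0) = 1 := mem_codeFlat_pair.1 hp _ h01 h02
      refine ⟨p, hC.mem_commonNeighbors h12 h02 hv' hp hvne (hv1.trans hp1.symm), ?_⟩
      simp [hp0, hp1, hx1.symm]
    · obtain ⟨p, hp, hp0, hp1⟩ := exists_mem_codeFlat_groupCode h01 x⁻¹
      have hp1' : p ≠ 1 := fun h => hx1 (inv_eq_one.1 (h ▸ hp0).symm)
      have hpv : v ≠ p := fun h => hxx (hv0.symm.trans (h ▸ hp0))
      refine ⟨p, ⟨(hC.adj_of_mem_codeFlat h01 hp hp1').symm,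
        hC.isClique_codeFlat 1 h01 hv hp hpv⟩, ?_⟩
      simp [hp0, hp1, hxx, hxx.symm]

end TrisectedEdge

theorem commute_of_mul_self_eq_one {G : Type*} [Group G] (hG : ∀ x : G, x * x = 1) (x y : G) :
    Commute x y :=
  Commute.of_orderOf_dvd_two (fun z => orderOf_dvd_of_pow_eq_one ((pow_two z).trans (hG z))) x y

theorem exists_adj_groupCode {G : Type*} [Group G] {n : ℕ} (hG : ∀ x : G, x * x = 1)
    {u v z : groupCode G n} {i j l : Fin n} (hij : i ≠ j) (hjl : j ≠ l)
    (hv : v ∈ codeFlat u {i, j}) (hvu : v ≠ u) (hz : z ∈ codeFlat u {i, l}) (h : v.1 i = z.1 i) :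
    ∃ w ∈ codeFlat u {j, l}, v.1 j = w.1 j ∧ (codeGraph (groupCode G n)).Adj z w := by
  let _ : CommGroup G := { ‹Group G› with mul_comm := commute_of_mul_self_eq_one hG }
  have hC := isLatinCode_groupCode (G := G) (n := n)
  have hne := (hC.ne_iff_of_mem_codeFlat hv hvu i).2 (Or.inl rfl)
  have hprod (p : groupCode G n) : ∏ k, p.1 k = 1 := (List.prod_ofFn).symm.trans p.2
  let w : groupCode G n := ⟨z.1 * u.1 * v.1, by
    simp [groupCode, List.prod_ofFn, Finset.prod_mul_distrib, hprod]⟩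
  have hw (k) : w.1 k = z.1 k * u.1 k * v.1 k := rfl
  rw [mem_codeFlat_pair] at hv hz
  have hwi : w.1 i = u.1 i := by rw [hw, mul_right_comm, ← h, hG, one_mul]
  have hwz : w ∈ codeFlat z {i, j} := mem_codeFlat_pair.2 fun k hki hkj => by
    rw [hw, hv k hki hkj, mul_assoc, hG, mul_one]
  refine ⟨w, mem_codeFlat_pair.2 fun k hkj hkl => ?_, ?_, ?_⟩
  · by_cases hki : k = i
    · rw [hki, hwi]
    · rw [mem_codeFlat_pair.1 hwz k hki hkj, hz k hki hkl]
  · rw [hw, hz j hij.symm hjl, hG, one_mul]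
  · exact (hC.adj_of_mem_codeFlat hij hwz fun h' => hne (h.trans (h' ▸ hwi))).symm

theorem IsLatinCode.color_eq_of_letter_eq {ι G κ : Type*} {C : Set (ι → G)} (hC : IsLatinCode C)
    {c : C → κ} {u v z w : C} {i j l l' : ι} (hv : v ∈ codeFlat u {i, j}) (hvu : v ≠ u)
    (hc : IsConstOnAdj (codeGraph C) ((codeGraph C).commonNeighbors u v) c)
    (hil : i ≠ l) (hjl : j ≠ l) (hz : z ∈ codeFlat u {i, l}) (hvz : v.1 i = z.1 i)
    (hil' : i ≠ l') (hjl' : j ≠ l') (hw : w ∈ codeFlat u {i, l'}) (hvw : v.1 i = w.1 i) :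
    c z = c w := by
  obtain rfl | hll := eq_or_ne l l'
  · rw [hC.eq_of_mem_codeFlat hz hw (hvz.symm.trans hvw)]
  · have hz' := hC.mem_commonNeighbors hil hjl hv hz hvu hvz
    exact hc z hz' w (hC.mem_commonNeighbors hil' hjl' hv hw hvu hvw)
      (hC.adj_of_letter_eq hil hll hz hw ((SimpleGraph.mem_commonNeighbors _).1 hz').1.ne'
        (hvz.symm.trans hvw))

theorem color_eq_of_notMem_codeFlat {G : Type*} [Group G] {n : ℕ} (hG : ∀ x : G, x * x = 1)
    {κ : Type*} {c : groupCode G n → κ} {u v z w : groupCode G n} {i j : Fin n} (hij : i ≠ j)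
    (hv : v ∈ codeFlat u {i, j}) (hvu : v ≠ u)
    (hc : IsConstOnAdj (codeGraph (groupCode G n))
      ((codeGraph (groupCode G n)).commonNeighbors u v) c)
    (hz : z ∈ (codeGraph (groupCode G n)).commonNeighbors u v) (hzL : z ∉ codeFlat u {i, j})
    (hw : w ∈ (codeGraph (groupCode G n)).commonNeighbors u v) (hwL : w ∉ codeFlat u {i, j}) :
    c z = c w := by
  have hC := isLatinCode_groupCode (G := G) (n := n)
  have hne := hC.ne_iff_of_mem_codeFlat hv hvu
  have hv' : v ∈ codeFlat u {j, i} := Set.pair_comm i j ▸ hv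
  have key : ∀ z ∈ (codeGraph (groupCode G n)).commonNeighbors u v, z ∉ codeFlat u {i, j} →
      ∃ z', c z = c z' ∧ ∃ l, l ≠ i ∧ l ≠ j ∧ z' ∈ codeFlat u {i, l} ∧ z'.1 i = v.1 i := by
    intro z hz hzL
    obtain h | h | ⟨l, hli, hlj, h, hzj⟩ := codeGraph_triangle hij hne hz.1 hz.2
    · exact absurd h hzL
    · exact ⟨z, rfl, h⟩
    · obtain ⟨z', hz', hzi, hadj⟩ :=
        exists_adj_groupCode hG hij.symm hli.symm hv' hvu h hzj.symm
      exact ⟨z', hc z hz z' (hC.mem_commonNeighbors hli.symm hlj.symm hv hz' hvu hzi) hadj,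
        l, hli, hlj, hz', hzi.symm⟩
  obtain ⟨z', hzz', l, hli, hlj, hz', hzi⟩ := key z hz hzL
  obtain ⟨w', hww', p, hpi, hpj, hw', hwi⟩ := key w hw hwL
  rw [hzz', hww']
  exact hC.color_eq_of_letter_eq hv hvu hc hli.symm hlj.symm hz' hzi.symm hpi.symm hpj.symm hw'
    hwi.symm

theorem not_hasTrisectedEdge {G : Type*} [Group G] {n : ℕ} (hG : ∀ x : G, x * x = 1) :
    ¬ HasTrisectedEdge (codeGraph (groupCode G n)) := by
  rintro ⟨u, v, ⟨i, j, hij, huv⟩, c, hc, hsurj⟩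
  have hC := isLatinCode_groupCode (G := G) (n := n)
  have hv : v ∈ codeFlat u {i, j} := mem_codeFlat_pair.2 fun k hki hkj => by grind
  have hvu : v ≠ u := by
    rintro rfl
    exact (huv i).2 (Or.inl rfl) rfl
  choose z hz hzc using hsurj
  have hclass (s t : Fin 3) (hst : z s ∈ codeFlat u {i, j} ↔ z t ∈ codeFlat u {i, j}) : s = t := by
    rw [← hzc s, ← hzc t]
    by_cases hs : z s ∈ codeFlat u {i, j}
    · obtain h | h := eq_or_ne (z s) (z t)
      · rw [h]
      · exact hc _ (hz s) _ (hz t) (hC.isClique_codeFlat u hij hs (hst.1 hs) h)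
    · exact color_eq_of_notMem_codeFlat hG hij hv hvu hc (hz s) hs (hz t) (hst.not.1 hs)
  have h01 := mt (hclass 0 1) (by decide)
  have h02 := mt (hclass 0 2) (by decide)
  have h12 := mt (hclass 1 2) (by decide)
  tauto

theorem hasTrisectedEdge_iff {G : Type*} [Group G] {n : ℕ} (hn : 3 ≤ n) :
    HasTrisectedEdge (codeGraph (groupCode G n)) ↔ ∃ x : G, x * x ≠ 1 := by
  refine ⟨fun h => ?_, fun ⟨x, hx⟩ => hasTrisectedEdge_of_mul_self_ne_one hn hx⟩
  by_contra! hG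
  exact not_hasTrisectedEdge hG h

section Cardinality

open Cardinal

theorem rank_eq_mk_of_infinite (K V : Type*) [Field K] [Finite K] [AddCommGroup V] [Module K V]
    [Infinite V] : Module.rank K V = #V := by
  let b := Module.Free.chooseBasis K V
  have hι : Infinite (Module.Free.ChooseBasisIndex K V) := not_finite_iff_infinite.1 fun _ =>
    not_finite_iff_infinite.2 ‹Infinite V› (.of_equiv _ b.equivFun.symm.toEquiv)
  have h := mk_congr_lift b.repr.toEquiv
  rw [mk_finsupp_lift_of_infinite, max_eq_left, ← Module.Free.rank_eq_card_chooseBasisIndex] at h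
  · simpa using h.symm
  · exact (lift_lt_aleph0.2 (mk_lt_aleph0 (α := K))).le.trans (aleph0_le_lift.2 (aleph0_le_mk _))

theorem cardinal_eq_of_pow_eq_pow {a b : Cardinal} {m : ℕ} (hm : m ≠ 0) (h : a ^ m = b ^ m) :
    a = b := by
  wlog hab : a ≤ b generalizing a b
  · exact (this h.symm (le_of_not_ge hab)).symm
  obtain ha | ha := lt_or_ge a ℵ₀
  · have hb : b < ℵ₀ := by
      by_contra! hb
      rw [power_nat_eq hb (Nat.one_le_iff_ne_zero.2 hm)] at h
      exact hb.not_gt (h ▸ power_natCast a m ▸ power_lt_aleph0 ha natCast_lt_aleph0)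
    lift a to ℕ using ha
    lift b to ℕ using hb
    exact congrArg _ (Nat.pow_left_injective hm (mod_cast h))
  · have h1 := Nat.one_le_iff_ne_zero.2 hm
    rwa [power_nat_eq ha h1, power_nat_eq (ha.trans hab) h1] at h

theorem nonempty_equiv_of_pi {G H : Type*} {m : ℕ} (hm : m ≠ 0) (e : (Fin m → G) ≃ (Fin m → H)) :
    Nonempty (G ≃ H) := by
  have h := mk_congr_lift e
  simp only [mk_pi, prod_const, mk_fin, lift_uzero, lift_power, lift_natCast] at h
  simp only [power_natCast] at h
  exact lift_mk_eq'.1 (cardinal_eq_of_pow_eq_pow hm h)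

theorem nonempty_linearEquiv_of_equiv {K V W : Type*} [Field K] [Finite K] [AddCommGroup V]
    [AddCommGroup W] [Module K V] [Module K W] (e : V ≃ W) : Nonempty (V ≃ₗ[K] W) := by
  refine nonempty_linearEquiv_of_lift_rank_eq ?_
  obtain _ | _ := finite_or_infinite V
  · have := Finite.of_equiv V e
    have h := Nat.card_congr e
    rw [Module.natCard_eq_pow_finrank (K := K) (V := V),
      Module.natCard_eq_pow_finrank (K := K) (V := W)] at h
    rw [← Module.finrank_eq_rank, ← Module.finrank_eq_rank,
      Nat.pow_right_injective Finite.one_lt_card h, lift_natCast, lift_natCast]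
  · have := Infinite.of_injective e e.injective
    rw [rank_eq_mk_of_infinite, rank_eq_mk_of_infinite]
    exact mk_congr_lift e

end Cardinality

theorem nonempty_mulEquiv_of_mul_self_eq_one {G H : Type*} [Group G] [Group H]
    (hG : ∀ x : G, x * x = 1) (hH : ∀ x : H, x * x = 1) (e : G ≃ H) : Nonempty (G ≃* H) := by
  let _ : CommGroup G := { ‹Group G› with mul_comm := commute_of_mul_self_eq_one hG }
  let _ : CommGroup H := { ‹Group H› with mul_comm := commute_of_mul_self_eq_one hH }
  let _ : Module (ZMod 2) (Additive G) :=
    AddCommGroup.zmodModule fun x => (two_nsmul x).trans (hG x.toMul)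
  let _ : Module (ZMod 2) (Additive H) :=
    AddCommGroup.zmodModule fun x => (two_nsmul x).trans (hH x.toMul)
  obtain ⟨f⟩ := nonempty_linearEquiv_of_equiv (K := ZMod 2) (V := Additive G) (W := Additive H) e
  exact ⟨AddEquiv.toMultiplicative f.toAddEquiv⟩

theorem three_le_orderOf_of_mul_self_ne_one {G : Type*} [Group G] [Finite G] {x : G}
    (hx : x * x ≠ 1) : 3 ≤ orderOf x := by
  have h0 : orderOf x ≠ 0 := (orderOf_pos x).ne'
  have h1 : orderOf x ≠ 1 := fun h => hx (by rw [orderOf_eq_one_iff.1 h, one_mul])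
  have h2 : orderOf x ≠ 2 := fun h => hx (by rw [← sq, ← h, pow_orderOf_eq_one])
  omega

theorem isCyclic_of_card_lt_six {G : Type*} [Group G] [Finite G] {x : G} (hx : x * x ≠ 1)
    (hG : Nat.card G < 6) : IsCyclic G :=
  isCyclic_of_orderOf_eq_card x (Nat.eq_of_dvd_of_lt_two_mul Nat.card_pos.ne'
    (orderOf_dvd_natCard x)
      (hG.trans_le (Nat.mul_le_mul_left 2 (three_le_orderOf_of_mul_self_ne_one hx)))).symm

theorem nonempty_mulEquiv_of_card_lt_six {G H : Type*} [Group G] [Group H] [Finite G] (e : G ≃ H)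
    (hG : Nat.card G < 6) {x : G} (hx : x * x ≠ 1) {y : H} (hy : y * y ≠ 1) :
    Nonempty (G ≃* H) := by
  have := Finite.of_equiv G e
  have hcard := Nat.card_congr e
  have := isCyclic_of_card_lt_six hx hG
  have := isCyclic_of_card_lt_six hy (hcard ▸ hG)
  exact ⟨mulEquivOfCyclicCardEq hcard⟩

theorem nonempty_mulEquiv_of_five_le_card {G H : Type*} [Group G] [Group H] {n : ℕ} (hn : 3 ≤ n)
    (hG : 5 ≤ ENat.card G) {x : G} (hx : x * x ≠ 1)
    (φ : codeGraph (groupCode G n) ≃g codeGraph (groupCode H n)) (hφ1 : φ 1 = 1) :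
    Nonempty (G ≃* H) := by
  have hφ : PreservesLines φ := isLatinCode_groupCode.preservesLines isLatinCode_groupCode hG φ
  obtain ⟨τ, hτ⟩ := exists_mapsPlane_groupCode hφ (Fin.castLEEmb hn) hx
  exact nonempty_mulEquiv_of_mapsPlane hφ hφ1 (Fin.strictMono_castLE hn) hτ

theorem intervalCayGraph_adj_comp {G H : Type*} [Group G] [Group H] {m : ℕ} (e : G ≃* H)
    {g h : Fin m → G} (hgh : (intervalCayGraph m G).Adj g h) :
    (intervalCayGraph m H).Adj (e ∘ g) (e ∘ h) := by
  obtain ⟨s, ⟨x, k, l, hx, hk, hkl, hl, rfl⟩, rfl⟩ := hgh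
  refine ⟨intervalElem m (e x) k l, ⟨_, _, _, by simpa using hx, hk, hkl, hl, rfl⟩, ?_⟩
  funext i
  simp only [Function.comp_apply, Pi.mul_apply, map_mul, intervalElem]
  split_ifs <;> simp

/-- The graph isomorphism that applies a group isomorphism to every coordinate. -/
def intervalCayGraphCongr {G H : Type*} [Group G] [Group H] (m : ℕ) (e : G ≃* H) :
    intervalCayGraph m G ≃g intervalCayGraph m H where
  toEquiv := .piCongrRight fun _ => e.toEquiv
  map_rel_iff' := by
    refine fun {g h} => ⟨fun hgh => ?_, intervalCayGraph_adj_comp e⟩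
    simpa [Function.comp_def] using intervalCayGraph_adj_comp e.symm hgh

theorem theorem6p12_general {G H : Type*} [Group G] [Group H] (m : ℕ) (hm : 1 < m) :
    Nonempty (intervalCayGraph m G ≃g intervalCayGraph m H) ↔ Nonempty (G ≃* H) := by
  refine ⟨fun ⟨ψ⟩ => ?_, fun ⟨e⟩ => ⟨intervalCayGraphCongr m e⟩⟩
  have hn : 3 ≤ m + 1 := Nat.succ_le_succ hm
  obtain ⟨e⟩ := nonempty_equiv_of_pi (Nat.ne_zero_of_lt hm) ψ.toEquiv
  obtain ⟨φ, hφ1⟩ := exists_codeGraph_iso ψ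
  by_cases hG : ∃ x : G, x * x ≠ 1
  · obtain ⟨y, hy⟩ := (hasTrisectedEdge_iff hn).1 (((hasTrisectedEdge_iff hn).2 hG).of_iso φ)
    obtain ⟨x, hx⟩ := hG
    obtain h5 | h5 := le_or_gt 5 (ENat.card G)
    · exact nonempty_mulEquiv_of_five_le_card hn h5 hx φ hφ1
    · have := ENat.card_lt_top.1 (h5.trans (ENat.natCast_lt_top 5))
      rw [ENat.card_eq_coe_natCard] at h5
      exact nonempty_mulEquiv_of_card_lt_six e (Nat.lt_succ_of_lt (mod_cast h5)) hx hy
  · have hH : ¬ ∃ y : H, y * y ≠ 1 := fun hH =>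
      hG ((hasTrisectedEdge_iff hn).1 (((hasTrisectedEdge_iff hn).2 hH).of_iso φ.symm))
    push Not at hG hH
    exact nonempty_mulEquiv_of_mul_self_eq_one hG hH e

theorem theorem6p12 {G : Type*} {H : Type*} [Group G] [Finite G] [Group H] [Finite H]
    (m : ℕ) (hm : 1 < m) :
    Nonempty (intervalCayGraph m G ≃g intervalCayGraph m H) ↔ Nonempty (G ≃* H) :=
  theorem6p12_general m hm
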